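/- Let $(\phi_n)_{n\ge 1}$ be functions $\phi_n:\mathbb{R}\to\mathbb{C}$ with $\sup_n\|\phi_n\|_\infty<\infty$ for which there are constants $L\ge 1$ and $\delta>0$ such that $$L^{-1}|x-y|\le |\phi_n(x)-\phi_n(y)|\le L|x-y|\qquad\text{whenever } |x-y|\le\delta,\ n\ge 1.$$ Let $a_n\in\mathbb{C}\setminus\{0\}$ with $\sum_{n\ge1}|a_n|<\infty$, and let $(\lambda_n)_{n\ge 1}$ be a nondecreasing real sequence with $\lambda_1=1$ and $q:=\sup_n\lambda_{n+1}/\lambda_n\in(1,\infty)$ (if $(\lambda_n)$ is strictly increasing, $q>1$ is automatic). Put $$s_k=\Bigl(\sum_{q^k\le\lambda_n<q^{k+1}}|a_n|^2\Bigr)^{1/2},\qquad \tau=\limsup_{k\to\infty}\frac{-\log s_k}{k\log q}\in[-\infty,\infty],\qquad -\log 0:=+\infty.$$ Let $\theta_1,\theta_2,\dots$ be independent random variables, each uniformly distributed on $[0,1]$, and let $$S(x)=\sum_{n=1}^\infty a_n e^{2\pi i\theta_n}\phi_n(\lambda_n x),\qquad x\in\mathbb{R}.$$ For a finite Borel measure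 $\mu$ on $\mathbb{C}=\mathbb{R}^2$ let $\widehat\mu(\xi)=\int e^{-2\pi i\langle\xi,u\rangle}\,d\mu(u)$ and $$\dim_{\mathcal S}\mu=\sup\Bigl\{s>0:\int_{\mathbb{R}^2}|\widehat\mu(\xi)|^2|\xi|^{s-2}\,d\xi<\infty\Bigr\}\in[0,\infty]\qquad(\sup\emptyset=0).$$ For $E\subset\mathbb{R}^2$ let $\dim_{\mathcal S}E\in[0,\infty]$ be the supremum of $\dim_{\mathcal S}\mu$ over all nonzero finite Borel measures $\mu$ on $\mathbb{R}^2$ whose support is a compact subset of $E$ (again $\sup\emptyset=0$). **Theorem 3.4.** If $0\le\tau<\infty$, then for every Borel set $A\subset\mathbb{R}$ with $\dim_{\mathcal H}A>0$, almost surely $$\dim_{\mathcal S}S(A)\ \ge\ \frac{\dim_{\mathcal H}A}{\tau},$$ where the right-hand side is $+\infty$ when $\tau=0$. -/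

import Mathlib

open MeasureTheory ProbabilityTheory Filter
open scoped ENNReal NNReal

noncomputable section

/-- Fourier transform of a measure on the plane `ℂ = ℝ²`:
`μ̂(ξ) = ∫ exp(-2πi ⟨ξ, u⟩) dμ(u)`, where `⟨ξ, u⟩ = Re (conj ξ * u)` is the Euclidean inner
product. -/
def measureFourier (μ : Measure ℂ) (ξ : ℂ) : ℂ :=
  ∫ u : ℂ, Complex.exp (-2 * (Real.pi : ℂ) * Complex.I * ((inner ℝ ξ u : ℝ) : ℂ)) ∂μ

/-- The Sobolev energy `∫_{ℝ²} |μ̂(ξ)|² |ξ|^(s-2) dξ ∈ [0, ∞]` of a measure on the plane. -/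
def sobolevEnergy (μ : Measure ℂ) (s : ℝ) : ℝ≥0∞ :=
  ∫⁻ ξ : ℂ, ENNReal.ofReal (‖measureFourier μ ξ‖ ^ 2 * ‖ξ‖ ^ (s - 2))

/-- Sobolev dimension in `[0, ∞]` of a finite Borel measure on the plane: the supremum of all
`s > 0` with finite Sobolev energy (and `0` if there is none). -/
def sobolevDimMeasure (μ : Measure ℂ) : ℝ≥0∞ :=
  ⨆ (s : ℝ≥0) (_ : 0 < s ∧ sobolevEnergy μ s < ∞), (s : ℝ≥0∞)

/-- `μ` is a nonzero finite Borel measure whose closed support is a compact subset of `E`. -/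
def SupportedMeasure (E : Set ℂ) (μ : Measure ℂ) : Prop :=
  IsFiniteMeasure μ ∧ μ ≠ 0 ∧ ∃ K : Set ℂ, IsCompact K ∧ K ⊆ E ∧ μ Kᶜ = 0

/-- Sobolev dimension of a planar set: the supremum of the Sobolev dimensions of the nonzero
finite Borel measures supported on it. -/
def sobolevDim (E : Set ℂ) : ℝ≥0∞ :=
  ⨆ (μ : Measure ℂ) (_ : SupportedMeasure E μ), sobolevDimMeasure μ

open Classical in
/-- `s_k = (∑_{q^k ≤ λ_n < q^(k+1)} |a_n|²)^(1/2)`. -/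
def blockNorm (q : ℝ) (lam : ℕ → ℝ) (a : ℕ → ℂ) (k : ℕ) : ℝ :=
  Real.sqrt (∑' n : ℕ, if q ^ k ≤ lam n ∧ lam n < q ^ (k + 1) then ‖a n‖ ^ 2 else 0)

/-- `limsup_k (-log s_k) / (k log q)` in the extended reals, with `-log 0 = +∞`. -/
def decayExponent (q : ℝ) (lam : ℕ → ℝ) (a : ℕ → ℂ) : EReal :=
  limsup (fun k : ℕ => -(ENNReal.log (ENNReal.ofReal (blockNorm q lam a k))) /
    (((k : ℝ) * Real.log q : ℝ) : EReal)) atTop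

/-- The series `∑_n a_n exp(2πi t_n) φ_n(λ_n x)` with phases `t`. -/
def phaseSeries (a : ℕ → ℂ) (lam : ℕ → ℝ) (φ : ℕ → ℝ → ℂ) (t : ℕ → ℝ) (x : ℝ) : ℂ :=
  ∑' n : ℕ, a n * Complex.exp (2 * (Real.pi : ℂ) * Complex.I * (t n : ℂ)) * φ n (lam n * x)

end

/-! Let ν be a measure on a compact part of `A` and μ its image under S. By Fubini, E|μ̂(ξ)|² is a
double ν-integral of the correlations of the characters at S(x) and S(y). Averaging a character over
a circle gives J₀, so by independence such a correlation is the product over n of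
J₀(2π|ξ||a_n||φ_n(λ_n x) − φ_n(λ_n y)|). No factor exceeds 1 in modulus, so any finite set of
indices gives an upper bound (`norm_integral_planeChar_le`).

Let r = |x − y| be small and τ' > τ. For λ_n slightly below δ/r the increments of φ_n are bounded
below, and because τ is a limsup, every block near that scale has ∑|a_n|² at least a constant times
r^(2τ'). Since |J₀(t)| ≤ (1 + t²)^(-κ) for all t ≥ 0 and ∏(1 + t_i²) ≥ 1 + ∑t_i², one block
contributes (1 + (b r^τ' |ξ|)²)^(-κ), however its mass is distributed. The size of κ is irrelevant:
m consecutive blocks raise the exponent to κm (`exists_prod_besselZero_le`).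

Once 2κm > s, integrating against |ξ|^(s-2) and rescaling gives a constant times r^(-sτ'). The
expected Sobolev energy of μ is thus controlled by the Riesz energy of ν of order sτ'
(`ae_sobolevEnergy_lt_top`). For s < dim A / τ one can choose τ' with sτ' < dim A, and Frostman's
lemma provides ν with finite energy.

Two classical ingredients are established on the way: Frostman's lemma for Borel sets, by Choquet
capacitability of the dyadic net content, and the decay of J₀, from Bessel's equation. -/

/-! ### Dyadic content on the line -/

/-- The half-open dyadic interval `[k / 2 ^ n, (k + 1) / 2 ^ n)` indexed by `p = (n, k)`. -/
def dyadicIco (p : ℕ × ℤ) : Set ℝ := {x | ⌊(2 : ℝ) ^ p.1 * x⌋ = p.2}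

/-- The cost `2 ^ (-n α)` of a dyadic interval of level `n`. -/
noncomputable def dyadicCost (α : ℝ) (p : ℕ × ℤ) : ℝ≥0∞ := ENNReal.ofReal ((1 / 2) ^ p.1) ^ α

/-- The union of a family of dyadic intervals. -/
def dyadicUnion (U : Set (ℕ × ℤ)) : Set ℝ := ⋃ p ∈ U, dyadicIco p

/-- The total cost of a family of dyadic intervals. -/
noncomputable def familyCost (α : ℝ) (U : Set (ℕ × ℤ)) : ℝ≥0∞ :=
  ∑' p, U.indicator (dyadicCost α) p

/-- The `α`-dimensional dyadic net content. -/
noncomputable def dyadicContent (α : ℝ) (E : Set ℝ) : ℝ≥0∞ :=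
  ⨅ (U : Set (ℕ × ℤ)) (_ : E ⊆ dyadicUnion U), familyCost α U

/-- The maximal intervals of a family of dyadic intervals. -/
def coarsest (U : Set (ℕ × ℤ)) : Set (ℕ × ℤ) :=
  {p ∈ U | ∀ q ∈ U, (dyadicIco p ∩ dyadicIco q).Nonempty → p.1 ≤ q.1}

lemma mem_dyadicUnion {U : Set (ℕ × ℤ)} {x : ℝ} :
    x ∈ dyadicUnion U ↔ ∃ p ∈ U, x ∈ dyadicIco p := by
  simp [dyadicUnion]

/-- An integer k is at most 2^n z exactly when 2^d k is at most 2^(n+d) z, so the finer floor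
determines the coarser one. This is the nestedness of dyadic intervals. -/
lemma floor_two_pow_eq_of_le {n m : ℕ} (h : n ≤ m) {x y : ℝ}
    (hxy : ⌊(2 : ℝ) ^ m * x⌋ = ⌊(2 : ℝ) ^ m * y⌋) : ⌊(2 : ℝ) ^ n * x⌋ = ⌊(2 : ℝ) ^ n * y⌋ := by
  obtain ⟨d, rfl⟩ := Nat.exists_eq_add_of_le h
  have key : ∀ (k : ℤ) (z : ℝ), k ≤ ⌊(2 : ℝ) ^ n * z⌋ ↔ 2 ^ d * k ≤ ⌊(2 : ℝ) ^ (n + d) * z⌋ := by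
    intro k z
    rw [Int.le_floor, Int.le_floor, pow_add]
    push_cast
    rw [show (2 : ℝ) ^ n * 2 ^ d * z = 2 ^ d * (2 ^ n * z) by ring]
    exact (mul_le_mul_iff_right₀ (by positivity)).symm
  apply eq_of_forall_le_iff
  intro k
  rw [key, key, hxy]

lemma dyadicIco_subset {p q : ℕ × ℤ} (h : p.1 ≤ q.1) (hpq : (dyadicIco p ∩ dyadicIco q).Nonempty) :
    dyadicIco q ⊆ dyadicIco p := by
  obtain ⟨x, hxp, hxq⟩ := hpq
  intro y hy
  simp only [dyadicIco, Set.mem_ofPred_eq] at *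
  rw [← hxp]
  exact floor_two_pow_eq_of_le h (hy.trans hxq.symm)

lemma coarsest_subset (U : Set (ℕ × ℤ)) : coarsest U ⊆ U := fun _ h => h.1

/-- Levels are natural numbers, so among the intervals of `U` containing a given point one has least
level; nestedness makes it maximal. -/
lemma dyadicUnion_subset_coarsest (U : Set (ℕ × ℤ)) : dyadicUnion U ⊆ dyadicUnion (coarsest U) := by
  classical
  intro x hx
  rw [mem_dyadicUnion] at hx ⊢
  have hex : ∃ n, ∃ p ∈ U, p.1 = n ∧ x ∈ dyadicIco p := by
    obtain ⟨p, hp, hxp⟩ := hx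
    exact ⟨p.1, p, hp, rfl, hxp⟩
  obtain ⟨p, hp, hpn, hxp⟩ := Nat.find_spec hex
  refine ⟨p, ⟨hp, fun q hq hpq => ?_⟩, hxp⟩
  by_contra! hlt
  have hxq : x ∈ dyadicIco q :=
    dyadicIco_subset hlt.le (by rwa [Set.inter_comm]) hxp
  have := Nat.find_min' hex ⟨q, hq, rfl, hxq⟩
  omega

lemma dyadicContent_le {α : ℝ} {E : Set ℝ} {U : Set (ℕ × ℤ)} (h : E ⊆ dyadicUnion U) :
    dyadicContent α E ≤ familyCost α U := iInf₂_le U h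

lemma dyadicContent_mono {α : ℝ} {E F : Set ℝ} (h : E ⊆ F) :
    dyadicContent α E ≤ dyadicContent α F :=
  le_iInf₂ fun _ hU => dyadicContent_le (h.trans hU)

lemma exists_family_lt {α : ℝ} {E : Set ℝ} {c : ℝ≥0∞} (h : dyadicContent α E < c) :
    ∃ U, E ⊆ dyadicUnion U ∧ familyCost α U < c := by
  simpa [dyadicContent, iInf_lt_iff] using h

lemma dyadicUnion_mono {U V : Set (ℕ × ℤ)} (h : U ⊆ V) : dyadicUnion U ⊆ dyadicUnion V :=
  Set.biUnion_subset_biUnion_left h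

/-- Strong subadditivity of the dyadic content, at the level of covering families. -/
lemma familyCost_coarsest_add_content_le {α : ℝ} {E F : Set ℝ} {U V : Set (ℕ × ℤ)}
    (hU : E ⊆ dyadicUnion U) (hV : F ⊆ dyadicUnion V) :
    familyCost α (coarsest (U ∪ V)) + dyadicContent α (E ∩ F) ≤ familyCost α U + familyCost α V := by
  classical
  set M := coarsest (U ∪ V) with hM
  -- The discarded intervals and those chosen twice still cover `E ∩ F`: if u ∈ `U` and v ∈ `V`
  -- share a point, either they have the same level and coincide, or the finer one is not maximal.
  -- An interval lying in both `M` and `R` belongs to `U ∩ V`, so it is also paid for twice on the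
  -- right.
  set R : Set (ℕ × ℤ) := (U \ M) ∪ (V \ M) ∪ (U ∩ V) with hR
  have hcov : E ∩ F ⊆ dyadicUnion R := by
    rintro x ⟨hxE, hxF⟩
    obtain ⟨u, hu, hxu⟩ := mem_dyadicUnion.1 (hU hxE)
    obtain ⟨v, hv, hxv⟩ := mem_dyadicUnion.1 (hV hxF)
    rw [mem_dyadicUnion]
    rcases lt_trichotomy u.1 v.1 with h | h | h
    · refine ⟨v, Or.inl (Or.inr ⟨hv, fun hvM => ?_⟩), hxv⟩
      have := hvM.2 u (Or.inl hu) ⟨x, hxv, hxu⟩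
      omega
    · have : u = v := by
        refine Prod.ext h ?_
        simp only [dyadicIco, Set.mem_ofPred_eq] at hxu hxv
        rw [← hxu, ← hxv, h]
      subst this
      exact ⟨u, Or.inr ⟨hu, hv⟩, hxu⟩
    · refine ⟨u, Or.inl (Or.inl ⟨hu, fun huM => ?_⟩), hxu⟩
      have := huM.2 v (Or.inr hv) ⟨x, hxu, hxv⟩
      omega
  refine (add_le_add_right (dyadicContent_le hcov) _).trans ?_
  rw [familyCost, familyCost, familyCost, familyCost, ← ENNReal.tsum_add, ← ENNReal.tsum_add]
  refine ENNReal.tsum_le_tsum fun p => ?_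
  have hMs : p ∈ M → p ∈ U ∨ p ∈ V := fun h => coarsest_subset _ h
  by_cases h1 : p ∈ M <;> by_cases h2 : p ∈ U <;> by_cases h3 : p ∈ V <;>
    simp_all [Set.indicator]

lemma familyCost_union_le {α : ℝ} (U V : Set (ℕ × ℤ)) :
    familyCost α (U ∪ V) ≤ familyCost α U + familyCost α V := by
  rw [familyCost, familyCost, familyCost, ← ENNReal.tsum_add]
  refine ENNReal.tsum_le_tsum fun p => ?_
  by_cases h2 : p ∈ U <;> by_cases h3 : p ∈ V <;> simp_all [Set.indicator]

lemma dyadicContent_union_le {α : ℝ} (E F : Set ℝ) :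
    dyadicContent α (E ∪ F) ≤ dyadicContent α E + dyadicContent α F := by
  refine ENNReal.le_of_forall_pos_le_add fun ε hε hfin => ?_
  have hE := (ENNReal.add_lt_top.1 hfin).1
  have hF := (ENNReal.add_lt_top.1 hfin).2
  have hε2 : (ε / 2 : ℝ≥0∞) ≠ 0 := by simpa using hε.ne'
  obtain ⟨U, hU, hUc⟩ := exists_family_lt (ENNReal.lt_add_right hE.ne hε2)
  obtain ⟨V, hV, hVc⟩ := exists_family_lt (ENNReal.lt_add_right hF.ne hε2)
  have : E ∪ F ⊆ dyadicUnion (U ∪ V) := Set.union_subset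
    (hU.trans (dyadicUnion_mono Set.subset_union_left))
    (hV.trans (dyadicUnion_mono Set.subset_union_right))
  calc _ ≤ _ := dyadicContent_le this
    _ ≤ _ := familyCost_union_le U V
    _ ≤ (dyadicContent α E + ε / 2) + (dyadicContent α F + ε / 2) := add_le_add hUc.le hVc.le
    _ = dyadicContent α E + dyadicContent α F + (ε / 2 + ε / 2) := by ring
    _ = _ := by rw [ENNReal.add_halves]

/-- The dyadic content is continuous along increasing sequences of arbitrary sets. -/
lemma dyadicContent_iUnion_le {α : ℝ} {E : ℕ → Set ℝ} (hE : Monotone E)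
    (hfin : ∀ n, dyadicContent α (E n) ≠ ∞) :
    dyadicContent α (⋃ n, E n) ≤ ⨆ n, dyadicContent α (E n) := by
  refine ENNReal.le_of_forall_pos_le_add fun ε hε _ => ?_
  obtain ⟨e, he, hesum⟩ := ENNReal.exists_pos_sum_of_countable (ε := ε) (by simpa using hε.ne') ℕ
  have hex : ∀ n, ∃ U, E n ⊆ dyadicUnion U ∧ familyCost α U < dyadicContent α (E n) + e n :=
    fun n => exists_family_lt (ENNReal.lt_add_right (hfin n) (by simpa using (he n).ne'))
  choose C hCcov hCcost using hex
  -- Near-optimal covers are merged one at a time, keeping maximal intervals. Strong subadditivity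
  -- with `E n ∩ E (n + 1) = E n` shows that the errors `e i` merely add up.
  let V : ℕ → Set (ℕ × ℤ) := fun n => Nat.rec (C 0) (fun k W => coarsest (W ∪ C (k + 1))) n
  have hVs : ∀ n, V (n + 1) = coarsest (V n ∪ C (n + 1)) := fun n => rfl
  have hVC : ∀ n, V n ⊆ ⋃ i, C i := by
    intro n
    induction n with
    | zero => exact Set.subset_iUnion C 0
    | succ n ih =>
      rw [hVs]
      exact (coarsest_subset _).trans (Set.union_subset ih (Set.subset_iUnion C _))
  have hVcov : ∀ n, E n ⊆ dyadicUnion (V n) := by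
    intro n
    cases n with
    | zero => exact hCcov 0
    | succ n =>
      rw [hVs]
      exact (hCcov _).trans ((dyadicUnion_mono Set.subset_union_right).trans
        (dyadicUnion_subset_coarsest _))
  have hVcost : ∀ n, familyCost α (V n) ≤
      dyadicContent α (E n) + ∑ i ∈ Finset.range (n + 1), (e i : ℝ≥0∞) := by
    intro n
    induction n with
    | zero => simpa [V] using (hCcost 0).le
    | succ n ih =>
      have h1 := familyCost_coarsest_add_content_le (α := α) (hVcov n) (hCcov (n + 1))
      rw [Set.inter_eq_left.2 (hE n.le_succ), ← hVs] at h1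
      have h2 := h1.trans (add_le_add ih (hCcost (n + 1)).le)
      rw [Finset.sum_range_succ _ (n + 1)]
      refine (ENNReal.add_le_add_iff_right (hfin n)).1 (h2.trans (le_of_eq ?_))
      ring
  -- An interval maximal among all the covers survives every merge after it first appears, so each
  -- finite part of `W` lies in a single `V N`.
  set W := coarsest (⋃ i, C i) with hW
  have hWV : ∀ n, ∀ w ∈ W, w ∈ C n → ∀ m, n ≤ m → w ∈ V m := by
    intro n w hw hwn m hm
    induction m, hm using Nat.le_induction with
    | base =>
      cases n with
      | zero => exact hwn
      | succ n =>
        rw [hVs]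
        refine ⟨Or.inr hwn, fun q hq => hw.2 q ?_⟩
        rcases hq with hq | hq
        · exact hVC _ hq
        · exact Set.mem_iUnion_of_mem _ hq
    | succ m hm ih =>
      rw [hVs]
      refine ⟨Or.inl ih, fun q hq => hw.2 q ?_⟩
      rcases hq with hq | hq
      · exact hVC _ hq
      · exact Set.mem_iUnion_of_mem _ hq
  have hWcov : (⋃ n, E n) ⊆ dyadicUnion W :=
    (Set.iUnion_subset fun n => (hCcov n).trans (dyadicUnion_mono (Set.subset_iUnion C n))).trans
      (dyadicUnion_subset_coarsest _)
  refine (dyadicContent_le hWcov).trans ?_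
  rw [familyCost, ENNReal.tsum_eq_iSup_sum]
  refine iSup_le fun s => ?_
  have hN : ∃ N, ∀ w ∈ s, w ∈ W → w ∈ V N := by
    have : ∀ w, ∃ n, w ∈ W → w ∈ C n := by
      intro w
      by_cases hw : w ∈ W
      · obtain ⟨n, hn⟩ := Set.mem_iUnion.1 (coarsest_subset _ hw)
        exact ⟨n, fun _ => hn⟩
      · exact ⟨0, fun h => absurd h hw⟩
    choose f hf using this
    exact ⟨s.sup f, fun w hws hw => hWV (f w) w hw (hf w hw) _ (Finset.le_sup hws)⟩
  obtain ⟨N, hN⟩ := hN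
  calc ∑ p ∈ s, W.indicator (dyadicCost α) p ≤ ∑ p ∈ s, (V N).indicator (dyadicCost α) p := by
        refine Finset.sum_le_sum fun p hp => ?_
        by_cases hpW : p ∈ W
        · simp [hpW, hN p hp hpW]
        · simp [hpW]
    _ ≤ familyCost α (V N) := ENNReal.sum_le_tsum s
    _ ≤ _ := hVcost N
    _ ≤ _ := add_le_add (le_iSup (fun n => dyadicContent α (E n)) N)
        ((ENNReal.sum_le_tsum _).trans hesum.le)

lemma dyadicContent_empty (α : ℝ) : dyadicContent α ∅ = 0 := by
  refine le_antisymm ((dyadicContent_le (U := ∅) (Set.empty_subset _)).trans ?_) zero_le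
  simp [familyCost]

/-- Translation of a family of dyadic intervals by `j` steps on every level. -/
def shiftFamily (j : ℤ) (U : Set (ℕ × ℤ)) : Set (ℕ × ℤ) := {p | (p.1, p.2 - j) ∈ U}

lemma familyCost_shiftFamily (α : ℝ) (j : ℤ) (U : Set (ℕ × ℤ)) :
    familyCost α (shiftFamily j U) = familyCost α U := by
  rw [familyCost, familyCost,
    ← ((Equiv.refl ℕ).prodCongr (Equiv.subRight j)).tsum_eq (U.indicator (dyadicCost α))]
  refine tsum_congr fun p => ?_
  change (shiftFamily j U).indicator (dyadicCost α) p = U.indicator (dyadicCost α) (p.1, p.2 - j)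
  by_cases h : (p.1, p.2 - j) ∈ U <;> simp [shiftFamily, Set.indicator, h, dyadicCost]

/-- A family of dyadic intervals can be thickened to an open set at the price of a factor `3`. -/
lemma exists_isOpen_between (α : ℝ) (U : Set (ℕ × ℤ)) :
    ∃ (O : Set ℝ) (V : Set (ℕ × ℤ)), IsOpen O ∧ dyadicUnion U ⊆ O ∧ O ⊆ dyadicUnion V ∧
      familyCost α V ≤ 3 * familyCost α U := by
  refine ⟨⋃ p ∈ U, {x : ℝ | (p.2 : ℝ) - 1 < 2 ^ p.1 * x ∧ (2 : ℝ) ^ p.1 * x < p.2 + 2},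
    (shiftFamily (-1) U ∪ shiftFamily 0 U) ∪ shiftFamily 1 U, ?_, ?_, ?_, ?_⟩
  · refine isOpen_biUnion fun p _ => ?_
    have h : Continuous fun x : ℝ => (2 : ℝ) ^ p.1 * x := by fun_prop
    exact (isOpen_lt continuous_const h).inter (isOpen_lt h continuous_const)
  · refine Set.biUnion_mono subset_rfl fun p _ x hx => ?_
    have h : ⌊(2 : ℝ) ^ p.1 * x⌋ = p.2 := hx
    rw [Int.floor_eq_iff] at h
    exact ⟨by linarith, by linarith⟩
  · refine Set.iUnion₂_subset fun p hp x hx => ?_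
    rw [mem_dyadicUnion]
    refine ⟨(p.1, ⌊(2 : ℝ) ^ p.1 * x⌋), ?_, rfl⟩
    obtain ⟨h1, h2⟩ := hx
    have h3 : p.2 - 1 ≤ ⌊(2 : ℝ) ^ p.1 * x⌋ := Int.le_floor.2 (by push_cast; linarith)
    have h4 : ⌊(2 : ℝ) ^ p.1 * x⌋ < p.2 + 2 := Int.floor_lt.2 (by push_cast; linarith)
    have h5 : ⌊(2 : ℝ) ^ p.1 * x⌋ = p.2 - 1 ∨ ⌊(2 : ℝ) ^ p.1 * x⌋ = p.2 ∨
      ⌊(2 : ℝ) ^ p.1 * x⌋ = p.2 + 1 := by omega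
    rcases h5 with h | h | h
    · refine Or.inl (Or.inl ?_)
      simpa [shiftFamily, h] using hp
    · refine Or.inl (Or.inr ?_)
      simpa [shiftFamily, h] using hp
    · refine Or.inr ?_
      simpa [shiftFamily, h] using hp
  · refine (familyCost_union_le _ _).trans ((add_le_add_left (familyCost_union_le _ _) _).trans ?_)
    simp only [familyCost_shiftFamily]
    apply le_of_eq
    ring

/-! ### Capacitability of analytic sets -/

/-- Among the sequences whose first coordinates are bounded by `m`, an open neighbourhood of the
compact box bounded by `m` contains all those with sufficiently many coordinates bounded. -/
lemma exists_forall_lt_le_subset {m : ℕ → ℕ} {V : Set (ℕ → ℕ)} (hV : IsOpen V)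
    (h : Set.pi Set.univ (fun i => Set.Iic (m i)) ⊆ V) : ∃ k, {x | ∀ i < k, x i ≤ m i} ⊆ V := by
  by_contra! hcon
  have : ∀ k, ∃ x : ℕ → ℕ, (∀ i < k, x i ≤ m i) ∧ x ∉ V := fun k => by
    obtain ⟨x, hx, hxV⟩ := Set.not_subset.1 (hcon k)
    exact ⟨x, hx, hxV⟩
  choose x hx hxV using this
  have hB : IsCompact (Set.pi Set.univ (fun i => Set.Iic (m i))) :=
    isCompact_univ_pi fun i => (Set.finite_Iic (m i)).isCompact
  -- Truncation into the box leaves the first k coordinates of `x k` unchanged, so the untruncated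
  -- subsequence has the same limit.
  obtain ⟨y, hy, ψ, hψ, hlim⟩ := hB.tendsto_subseq (x := fun k i => min (x k i) (m i))
    (fun k i _ => Set.mem_Iic.2 (min_le_right _ _))
  have hlim2 : Tendsto (x ∘ ψ) atTop (nhds y) := by
    rw [tendsto_pi_nhds] at hlim ⊢
    intro i
    refine (hlim i).congr' ?_
    filter_upwards [eventually_gt_atTop i] with k hk
    exact min_eq_left (hx _ i (hk.trans_le hψ.le_apply))
  exact hV.isClosed_compl.mem_of_tendsto hlim2 (Eventually.of_forall fun k => hxV _) (h hy)

/-- An analytic set of positive dyadic content has a compact subset of positive content. -/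
lemma exists_isCompact_content_pos {α : ℝ} {A : Set ℝ} (hA : AnalyticSet A)
    (hfin : dyadicContent α A ≠ ∞) (hpos : 0 < dyadicContent α A) :
    ∃ K ⊆ A, IsCompact K ∧ 0 < dyadicContent α K := by
  rw [AnalyticSet] at hA
  obtain rfl | ⟨g, hg, rfl⟩ := hA
  · simp [dyadicContent_empty] at hpos
  obtain ⟨η, hη0, hη⟩ := exists_between hpos
  -- Choquet's argument: continuity along increasing sequences allows the coordinates to be bounded
  -- one after another while the content of the image stays above `η`.
  have hstep : ∀ (k : ℕ) (S : {S : Set (ℕ → ℕ) // η < dyadicContent α (g '' S)}),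
      ∃ m : ℕ, η < dyadicContent α (g '' (S.1 ∩ {x | x k ≤ m})) := by
    intro k S
    have hmono : Monotone fun m : ℕ => g '' (S.1 ∩ {x | x k ≤ m}) := fun a b hab =>
      Set.image_mono (Set.inter_subset_inter_right _ fun x (hx : x k ≤ a) => hx.trans hab)
    have hU : (⋃ m : ℕ, g '' (S.1 ∩ {x | x k ≤ m})) = g '' S.1 := by
      rw [← Set.image_iUnion, ← Set.inter_iUnion]
      congr 1
      refine Set.inter_eq_left.2 fun x _ => Set.mem_iUnion.2 ⟨x k, le_refl (x k)⟩
    have h1 := dyadicContent_iUnion_le (α := α) hmono fun m =>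
      ne_top_of_le_ne_top hfin (dyadicContent_mono (Set.image_subset_range _ _))
    rw [hU] at h1
    exact lt_iSup_iff.1 (S.2.trans_le h1)
  choose mm hmm using hstep
  let S : ℕ → {S : Set (ℕ → ℕ) // η < dyadicContent α (g '' S)} := fun n =>
    Nat.rec ⟨Set.univ, by rwa [Set.image_univ]⟩
      (fun k S => ⟨S.1 ∩ {x | x k ≤ mm k S}, hmm k S⟩) n
  have hSs : ∀ k, (S (k + 1)).1 = (S k).1 ∩ {x | x k ≤ mm k (S k)} := fun k => rfl
  set m : ℕ → ℕ := fun k => mm k (S k) with hm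
  have hS : ∀ k, (S k).1 = {x | ∀ i < k, x i ≤ m i} := by
    intro k
    induction k with
    | zero => simp [S]
    | succ k ih =>
      rw [hSs, ih]
      ext x
      simp only [Set.mem_inter_iff, Set.mem_ofPred_eq, Nat.lt_succ_iff_lt_or_eq]
      constructor
      · rintro ⟨h1, h2⟩ i (hi | rfl)
        exacts [h1 i hi, h2]
      · exact fun h => ⟨fun i hi => h i (Or.inl hi), h k (Or.inr rfl)⟩
  refine ⟨g '' Set.pi Set.univ (fun i => Set.Iic (m i)), Set.image_subset_range _ _,
    (isCompact_univ_pi fun i => (Set.finite_Iic (m i)).isCompact).image hg, ?_⟩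
  -- Covers must be thickened to open sets before compactness applies, which costs a factor 3; hence
  -- only content at least `η / 3` is retained.
  have hη3 : 0 < η / 3 := ENNReal.div_pos hη0.ne' (by norm_num)
  refine hη3.trans_le (le_of_not_gt fun hlt => ?_)
  obtain ⟨U, hU, hUc⟩ := exists_family_lt hlt
  obtain ⟨O, V, hO, hUO, hOV, hVc⟩ := exists_isOpen_between α U
  obtain ⟨k, hk⟩ := exists_forall_lt_le_subset (hO.preimage hg)
    (Set.image_subset_iff.1 (hU.trans hUO))
  rw [← hS, ← Set.image_subset_iff] at hk
  have h1 := (S k).2.trans_le ((dyadicContent_le (hk.trans hOV)).trans hVc)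
  have h2 : 3 * familyCost α U ≤ 3 * (η / 3) := by gcongr
  rw [ENNReal.mul_div_cancel (by norm_num) (by norm_num)] at h2
  exact absurd (h1.trans_le h2) (lt_irrefl _)

/-! ### Hausdorff measure and Frostman's lemma -/

lemma ediam_dyadicIco_le (p : ℕ × ℤ) : Metric.ediam (dyadicIco p) ≤ ENNReal.ofReal ((1 / 2) ^ p.1) := by
  refine Metric.ediam_le fun x hx y hy => ?_
  rw [edist_dist]
  apply ENNReal.ofReal_le_ofReal
  have h1 : ⌊(2 : ℝ) ^ p.1 * x⌋ = p.2 := hx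
  have h2 : ⌊(2 : ℝ) ^ p.1 * y⌋ = p.2 := hy
  have h3 := (Int.abs_sub_lt_one_of_floor_eq_floor (h1.trans h2.symm)).le
  rw [← mul_sub, abs_mul, abs_of_pos (by positivity)] at h3
  rw [Real.dist_eq, one_div, inv_pow, ← one_div, le_div_iff₀ (by positivity)]
  linarith

/-- Sets of vanishing dyadic content are null for the Hausdorff measure. -/
lemma hausdorffMeasure_eq_zero_of_content {α : ℝ} (hα : 0 < α) {A : Set ℝ}
    (h : dyadicContent α A = 0) : μH[α] A = 0 := by
  have hex : ∀ n : ℕ, ∃ U, A ⊆ dyadicUnion U ∧ familyCost α U < ((n : ℝ≥0∞) + 1)⁻¹ := fun n =>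
    exists_family_lt (by rw [h]; simp)
  choose U hU hUc using hex
  have he : Tendsto (fun n : ℕ => ((n : ℝ≥0∞) + 1)⁻¹) atTop (nhds 0) := by
    have := (tendsto_add_atTop_iff_nat 1).2 ENNReal.tendsto_inv_nat_nhds_zero
    simpa using this
  have hdiam : ∀ n, ∀ p ∈ U n, Metric.ediam (dyadicIco p) ^ α ≤ (U n).indicator (dyadicCost α) p := by
    intro n p hp
    rw [Set.indicator_of_mem hp, dyadicCost]
    exact ENNReal.rpow_le_rpow (ediam_dyadicIco_le p) hα.le
  have hle := Measure.hausdorffMeasure_le_liminf_tsum α A (l := atTop)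
    (fun n : ℕ => (((n : ℝ≥0∞) + 1)⁻¹) ^ α⁻¹) ?_ (fun n (p : U n) => dyadicIco p.1) ?_ ?_
  · refine le_antisymm (hle.trans ?_) zero_le
    calc _ ≤ liminf (fun n : ℕ => ((n : ℝ≥0∞) + 1)⁻¹) atTop := by
          refine liminf_le_liminf (Eventually.of_forall fun n => ?_)
          refine le_trans ?_ (hUc n).le
          calc _ ≤ ∑' p : U n, (U n).indicator (dyadicCost α) p.1 :=
                ENNReal.tsum_le_tsum fun p => hdiam n p.1 p.2
            _ ≤ familyCost α (U n) := ENNReal.tsum_comp_le_tsum_of_injective Subtype.val_injective _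
      _ = 0 := he.liminf_eq
  · have := he.ennrpow_const α⁻¹
    rwa [ENNReal.zero_rpow_of_pos (inv_pos.2 hα)] at this
  · refine Eventually.of_forall fun n p => ?_
    rw [ENNReal.le_rpow_inv_iff hα]
    exact (hdiam n p.1 p.2).trans ((ENNReal.le_tsum p.1).trans (hUc n).le)
  · refine Eventually.of_forall fun n => ?_
    refine (hU n).trans ?_
    rw [dyadicUnion, Set.biUnion_eq_iUnion]

lemma familyCost_singleton (α : ℝ) (p : ℕ × ℤ) : familyCost α {p} = dyadicCost α p := by
  rw [familyCost, tsum_eq_single p]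
  · simp
  · intro b hb; simp [hb]

/-- With 2^(-n-1) < y − x ≤ 2^(-n), two intervals of level n suffice. Length at most 1 is needed
because levels start at 0. -/
lemma dyadicContent_Ioc_le {α : ℝ} (hα : 0 < α) {x y : ℝ} (hxy : x < y) (h1 : y - x ≤ 1) :
    dyadicContent α (Set.Ioc x y) ≤ 2 * ENNReal.ofReal (2 * (y - x)) ^ α := by
  obtain ⟨n, hn1, hn2⟩ := exists_nat_pow_near_of_lt_one (sub_pos.2 hxy) h1
    (by norm_num : (0 : ℝ) < 1 / 2) (by norm_num)
  have hcov : Set.Ioc x y ⊆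
      dyadicUnion ({(n, ⌊(2 : ℝ) ^ n * x⌋)} ∪ {(n, ⌊(2 : ℝ) ^ n * x⌋ + 1)}) := by
    intro z hz
    rw [mem_dyadicUnion]
    have h2 : (2 : ℝ) ^ n * z ≤ 2 ^ n * x + 1 := by
      have : (2 : ℝ) ^ n * (z - x) ≤ 2 ^ n * (1 / 2) ^ n := by
        gcongr
        linarith [hz.2]
      rw [← mul_pow] at this
      norm_num at this
      linarith
    have h3 : (2 : ℝ) ^ n * x ≤ 2 ^ n * z := by
      gcongr
      exact hz.1.le
    have h4 : ⌊(2 : ℝ) ^ n * x⌋ ≤ ⌊(2 : ℝ) ^ n * z⌋ := Int.floor_le_floor h3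
    have h5 : ⌊(2 : ℝ) ^ n * z⌋ ≤ ⌊(2 : ℝ) ^ n * x⌋ + 1 := by
      rw [← Int.floor_add_one]
      exact Int.floor_le_floor h2
    refine ⟨(n, ⌊(2 : ℝ) ^ n * z⌋), ?_, rfl⟩
    have : ⌊(2 : ℝ) ^ n * z⌋ = ⌊(2 : ℝ) ^ n * x⌋ ∨ ⌊(2 : ℝ) ^ n * z⌋ = ⌊(2 : ℝ) ^ n * x⌋ + 1 := by
      omega
    rcases this with h | h <;> simp [h]
  refine (dyadicContent_le hcov).trans ((familyCost_union_le _ _).trans ?_)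
  rw [familyCost_singleton, familyCost_singleton, dyadicCost, dyadicCost, two_mul]
  have : ENNReal.ofReal ((1 / 2) ^ n) ≤ ENNReal.ofReal (2 * (y - x)) := by
    apply ENNReal.ofReal_le_ofReal
    rw [pow_succ] at hn1
    linarith
  gcongr

/-- **Frostman's lemma** on the line. -/
theorem exists_frostman_measure {A : Set ℝ} (hA : MeasurableSet A) {α : ℝ≥0} (hα : 0 < α)
    (hdim : α < dimH A) :
    ∃ (K : Set ℝ) (ν : Measure ℝ), K ⊆ A ∧ IsCompact K ∧ IsFiniteMeasure ν ∧ ν ≠ 0 ∧ ν Kᶜ = 0 ∧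
      ∀ x y, x < y → y - x ≤ 1 →
        ν (Set.Ioc x y) ≤ 2 * ENNReal.ofReal (2 * (y - x)) ^ (α : ℝ) := by
  have hα' : (0 : ℝ) < α := by exact_mod_cast hα
  -- Cutting into unit pieces makes all contents finite, as continuity along increasing sequences
  -- requires.
  have hU : A = ⋃ j : ℤ, A ∩ Set.Ioc (j : ℝ) (j + 1) := by
    rw [← Set.inter_iUnion, iUnion_Ioc_intCast, Set.inter_univ]
  rw [hU, dimH_iUnion, lt_iSup_iff] at hdim
  obtain ⟨j, hj⟩ := hdim
  set A' := A ∩ Set.Ioc (j : ℝ) (j + 1) with hA'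
  have hIoc : dyadicContent α (Set.Ioc (j : ℝ) (j + 1)) ≠ ∞ := by
    refine ne_top_of_le_ne_top ?_ (dyadicContent_Ioc_le hα' (by linarith) (by linarith))
    exact ENNReal.mul_ne_top (by norm_num) (ENNReal.rpow_ne_top_of_nonneg hα'.le (by simp))
  have hfin : ∀ B ⊆ Set.Ioc (j : ℝ) (j + 1), dyadicContent α B ≠ ∞ := fun B hB =>
    ne_top_of_le_ne_top hIoc (dyadicContent_mono hB)
  have hpos : 0 < dyadicContent α A' := by
    refine pos_iff_ne_zero.2 fun h0 => ?_
    have h1 := hausdorffMeasure_eq_zero_of_content hα' h0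
    rw [hausdorffMeasure_of_lt_dimH hj] at h1
    exact ENNReal.top_ne_zero h1
  obtain ⟨K, hKA, hK, hKpos⟩ := exists_isCompact_content_pos
    (hA.inter measurableSet_Ioc).analyticSet (hfin _ Set.inter_subset_right) hpos
  have hKI : K ⊆ Set.Ioc (j : ℝ) (j + 1) := hKA.trans Set.inter_subset_right
  have hKfin : ∀ B, dyadicContent α (K ∩ B) ≠ ∞ := fun B => hfin _ (Set.inter_subset_left.trans hKI)
  -- The Frostman measure is the Stieltjes measure of x ↦ content of `K ∩ (-∞, x]`. Subadditivity
  -- bounds its increments by the content of `K ∩ (x, y]`, giving at once the Hölder bound, right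
  -- continuity and the absence of mass in gaps of `K`.
  set F : ℝ → ℝ := fun x => (dyadicContent α (K ∩ Set.Iic x)).toReal with hF
  have hmono : Monotone F := fun x y hxy => ENNReal.toReal_mono (hKfin _)
    (dyadicContent_mono (Set.inter_subset_inter_right _ (Set.Iic_subset_Iic.2 hxy)))
  have hsub : ∀ x y, x < y →
      ENNReal.ofReal (F y - F x) ≤ dyadicContent α (K ∩ Set.Ioc x y) := by
    intro x y hxy
    have h1 : K ∩ Set.Iic y = (K ∩ Set.Iic x) ∪ (K ∩ Set.Ioc x y) := by
      rw [← Set.inter_union_distrib_left, Set.Iic_union_Ioc_eq_Iic hxy.le]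
    have h2 : dyadicContent α (K ∩ Set.Iic y) ≤
        dyadicContent α (K ∩ Set.Iic x) + dyadicContent α (K ∩ Set.Ioc x y) := by
      rw [h1]; exact dyadicContent_union_le _ _
    apply ENNReal.ofReal_le_of_le_toReal
    have h3 := ENNReal.toReal_mono (ENNReal.add_ne_top.2 ⟨hKfin _, hKfin _⟩) h2
    rw [ENNReal.toReal_add (hKfin _) (hKfin _)] at h3
    simp only [hF]
    linarith
  have hhold : ∀ x y, x < y → y - x ≤ 1 →
      ENNReal.ofReal (F y - F x) ≤ 2 * ENNReal.ofReal (2 * (y - x)) ^ (α : ℝ) := fun x y hxy h1 =>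
    (hsub x y hxy).trans ((dyadicContent_mono Set.inter_subset_right).trans
      (dyadicContent_Ioc_le hα' hxy h1))
  have hcont : ∀ x, ContinuousWithinAt F (Set.Ici x) x := by
    intro x
    rw [← continuousWithinAt_Ioi_iff_Ici, ContinuousWithinAt]
    have hz : Tendsto (fun y => F y - F x) (nhdsWithin x (Set.Ioi x)) (nhds 0) := by
      have hlim : Tendsto (fun y : ℝ => 2 * ENNReal.ofReal (2 * (y - x)) ^ (α : ℝ))
          (nhdsWithin x (Set.Ioi x)) (nhds 0) := by
        have h1 : Tendsto (fun y : ℝ => ENNReal.ofReal (2 * (y - x))) (nhds x) (nhds 0) := by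
          have h0 : Continuous fun y : ℝ => ENNReal.ofReal (2 * (y - x)) :=
            ENNReal.continuous_ofReal.comp (by fun_prop)
          simpa using h0.tendsto x
        have h2 := ENNReal.Tendsto.const_mul (a := 2) (h1.ennrpow_const (α : ℝ)) (Or.inr (by norm_num))
        rw [ENNReal.zero_rpow_of_pos hα', mul_zero] at h2
        exact h2.mono_left nhdsWithin_le_nhds
      have h3 : Tendsto (fun y => ENNReal.ofReal (F y - F x)) (nhdsWithin x (Set.Ioi x)) (nhds 0) := by
        refine tendsto_of_tendsto_of_tendsto_of_le_of_le' tendsto_const_nhds hlim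
          (Eventually.of_forall fun _ => zero_le) ?_
        filter_upwards [Ioc_mem_nhdsGT (lt_add_one x)] with y hy
        exact hhold x y hy.1 (by linarith [hy.2])
      have h4 := (ENNReal.tendsto_toReal ENNReal.zero_ne_top).comp h3
      refine h4.congr' ?_
      filter_upwards [self_mem_nhdsWithin] with y hy
      exact ENNReal.toReal_ofReal (sub_nonneg.2 (hmono (le_of_lt hy)))
    simpa using hz.add_const (F x)
  let f : StieltjesFunction ℝ := ⟨F, hmono, hcont⟩
  have hIocf : ∀ x y, f.measure (Set.Ioc x y) = ENNReal.ofReal (F y - F x) := f.measure_Ioc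
  refine ⟨K, f.measure, hKA.trans Set.inter_subset_left, hK, ?_, ?_, ?_, fun x y hxy h1 => ?_⟩
  · refine f.isFiniteMeasure_of_forall_abs_le (C := (dyadicContent α K).toReal) fun x => ?_
    change |F x| ≤ _
    rw [abs_of_nonneg ENNReal.toReal_nonneg]
    exact ENNReal.toReal_mono (hfin _ hKI) (dyadicContent_mono Set.inter_subset_left)
  · intro h0
    have h1 := hIocf j (j + 1)
    have h2 : K ∩ Set.Iic (j : ℝ) = ∅ := by
      ext z
      simp only [Set.mem_inter_iff, Set.mem_Iic, Set.mem_empty_iff_false, iff_false, not_and, not_le]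
      exact fun hz => (hKI hz).1
    have h3 : K ∩ Set.Iic ((j : ℝ) + 1) = K := Set.inter_eq_left.2 fun z hz => (hKI hz).2
    simp only [h0, hF, h2, h3, dyadicContent_empty, ENNReal.toReal_zero, sub_zero,
      Measure.coe_zero, Pi.zero_apply] at h1
    rw [ENNReal.ofReal_toReal (hfin _ hKI)] at h1
    exact hKpos.ne h1
  · refine measure_null_of_locally_null _ fun x hx => ?_
    obtain ⟨ε, hε, hball⟩ := Metric.isOpen_iff.1 hK.isClosed.isOpen_compl x hx
    refine ⟨Set.Ioc (x - ε / 2) (x + ε / 2),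
      mem_nhdsWithin_of_mem_nhds (Ioc_mem_nhds (by linarith) (by linarith)), ?_⟩
    rw [hIocf]
    refine le_antisymm ((hsub _ _ (by linarith)).trans ?_) zero_le
    have : K ∩ Set.Ioc (x - ε / 2) (x + ε / 2) = ∅ := by
      ext z
      simp only [Set.mem_inter_iff, Set.mem_empty_iff_false, iff_false, not_and]
      intro hz hz2
      refine hball ?_ hz
      rw [Metric.mem_ball, Real.dist_eq, abs_lt]
      exact ⟨by linarith [hz2.1], by linarith [hz2.2]⟩
    rw [this, dyadicContent_empty]
  · rw [hIocf]
    exact hhold x y hxy h1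

/-! ### Riesz energy of Frostman measures -/

/-- A dyadic decomposition of the kernel into balls; on the diagonal both sides are infinite. Radii
start at 1/4 so that each ball lies in an interval of length at most 1, where the Frostman bound
applies. -/
lemma edist_rpow_neg_le {β : ℝ} (hβ : 0 < β) (x y : ℝ) :
    edist x y ^ (-β) ≤ ENNReal.ofReal (4 ^ β) + ∑' n : ℕ,
      (Metric.closedBall x ((1 / 2) ^ (n + 2))).indicator
        (fun _ => ENNReal.ofReal ((2 ^ (n + 3)) ^ β)) y := by
  rcases eq_or_ne x y with rfl | hxy
  · have h1 : (∑' n : ℕ, (Metric.closedBall x ((1 / 2) ^ (n + 2))).indicator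
        (fun _ => ENNReal.ofReal ((2 ^ (n + 3)) ^ β)) x) = ∞ := by
      refine eq_top_iff.2 ?_
      rw [← ENNReal.tsum_const_eq_top_of_ne_zero (α := ℕ) one_ne_zero]
      refine ENNReal.tsum_le_tsum fun n => ?_
      rw [Set.indicator_of_mem (Metric.mem_closedBall_self (by positivity))]
      rw [← ENNReal.ofReal_one]
      apply ENNReal.ofReal_le_ofReal
      exact Real.one_le_rpow (one_le_pow₀ (by norm_num)) hβ.le
    rw [h1]
    simp
  · have hd : 0 < dist x y := dist_pos.2 hxy
    have hE : edist x y ^ (-β) = ENNReal.ofReal ((dist x y)⁻¹ ^ β) := by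
      rw [edist_dist, ENNReal.ofReal_rpow_of_pos hd, Real.rpow_neg hd.le, Real.inv_rpow hd.le]
    rw [hE]
    rcases lt_or_ge (1 / 4) (dist x y) with h | h
    · refine le_add_of_le_of_nonneg (ENNReal.ofReal_le_ofReal ?_) zero_le
      refine Real.rpow_le_rpow (by positivity) ?_ hβ.le
      rw [inv_le_comm₀ hd (by norm_num)]
      linarith
    · obtain ⟨n, hn1, hn2⟩ := exists_nat_pow_near_of_lt_one (x := 4 * dist x y) (y := (1 / 2 : ℝ))
        (by positivity) (by linarith) (by norm_num) (by norm_num)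
      refine le_add_of_nonneg_of_le zero_le (le_trans ?_ (ENNReal.le_tsum n))
      have hmem : y ∈ Metric.closedBall x ((1 / 2) ^ (n + 2)) := by
        rw [Metric.mem_closedBall, dist_comm, pow_add]
        linarith
      rw [Set.indicator_of_mem hmem]
      apply ENNReal.ofReal_le_ofReal
      refine Real.rpow_le_rpow (by positivity) ?_ hβ.le
      rw [inv_le_comm₀ hd (by positivity), ← inv_pow, inv_eq_one_div, pow_add]
      rw [pow_add] at hn1
      linarith

/-- At distance about 2^(-n) the kernel is of order 2^(nβ) and the ball has mass O(2^(-nα)), so the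
potential is bounded uniformly in x by a geometric series of ratio 2^(β-α). -/
lemma exists_bound_lintegral_edist {ν : Measure ℝ} [IsFiniteMeasure ν] {α β : ℝ} (hβ : 0 < β)
    (hβα : β < α)
    (hν : ∀ x y, x < y → y - x ≤ 1 → ν (Set.Ioc x y) ≤ 2 * ENNReal.ofReal (2 * (y - x)) ^ α) :
    ∫⁻ x, ∫⁻ y, edist x y ^ (-β) ∂ν ∂ν < ∞ := by
  have hα : 0 < α := hβ.trans hβα
  set ρ : ℝ := 2 ^ (β - α) with hρ
  have hρ1 : ρ < 1 := Real.rpow_lt_one_of_one_lt_of_neg (by norm_num) (by linarith)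
  have hρ0 : 0 < ρ := by positivity
  set C : ℝ≥0∞ := ENNReal.ofReal (4 ^ β) * ν Set.univ +
    ∑' n : ℕ, ENNReal.ofReal (8 ^ β * (2 * 2 ^ α) * ρ ^ n) with hC
  have hCtop : C < ∞ := by
    refine ENNReal.add_lt_top.2 ⟨ENNReal.mul_lt_top (by simp) (measure_lt_top _ _), ?_⟩
    rw [← ENNReal.ofReal_tsum_of_nonneg (fun n => by positivity)
      ((summable_geometric_of_lt_one hρ0.le hρ1).mul_left _)]
    exact ENNReal.ofReal_lt_top
  have hball : ∀ (x : ℝ) (n : ℕ), ν (Metric.closedBall x ((1 / 2) ^ (n + 2))) ≤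
      ENNReal.ofReal (2 * (2 * (1 / 2) ^ n) ^ α) := by
    intro x n
    set r : ℝ := (1 / 2) ^ (n + 2) with hr
    have hr0 : 0 < r := by positivity
    have hr1 : r = (1 / 2) ^ n / 4 := by rw [hr, pow_add]; ring
    have hn1 : ((1 : ℝ) / 2) ^ n ≤ 1 := pow_le_one₀ (by norm_num) (by norm_num)
    have hsub : Metric.closedBall x r ⊆ Set.Ioc (x - 2 * r) (x + r) := by
      intro y hy
      rw [Metric.mem_closedBall, Real.dist_eq, abs_le] at hy
      exact ⟨by linarith [hy.1], by linarith [hy.2]⟩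
    refine (measure_mono hsub).trans ((hν _ _ (by linarith) (by linarith)).trans ?_)
    rw [ENNReal.ofReal_rpow_of_nonneg (by linarith) hα.le, ENNReal.ofReal_mul (by norm_num),
      ENNReal.ofReal_ofNat]
    gcongr
    · linarith
    · linarith
  have hbound : ∀ x, ∫⁻ y, edist x y ^ (-β) ∂ν ≤ C := by
    intro x
    calc ∫⁻ y, edist x y ^ (-β) ∂ν ≤ ∫⁻ y, (ENNReal.ofReal (4 ^ β) + ∑' n : ℕ,
          (Metric.closedBall x ((1 / 2) ^ (n + 2))).indicator
            (fun _ => ENNReal.ofReal ((2 ^ (n + 3)) ^ β)) y) ∂ν :=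
          lintegral_mono fun y => edist_rpow_neg_le hβ x y
      _ = ENNReal.ofReal (4 ^ β) * ν Set.univ + ∑' n : ℕ,
          ENNReal.ofReal ((2 ^ (n + 3)) ^ β) * ν (Metric.closedBall x ((1 / 2) ^ (n + 2))) := by
          rw [lintegral_add_left measurable_const, lintegral_const, lintegral_tsum]
          · congr 1
            refine tsum_congr fun n => ?_
            rw [lintegral_indicator_const Metric.isClosed_closedBall.measurableSet]
          · exact fun n => (measurable_const.indicator
              Metric.isClosed_closedBall.measurableSet).aemeasurable
      _ ≤ C := by
          refine add_le_add_right (ENNReal.tsum_le_tsum fun n => ?_) _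
          refine (mul_le_mul_right (hball x n) _).trans ?_
          rw [← ENNReal.ofReal_mul (by positivity)]
          apply ENNReal.ofReal_le_ofReal
          apply le_of_eq
          have e1 : ((2 : ℝ) ^ (n + 3)) ^ β = 8 ^ β * (2 ^ β) ^ n := by
            rw [pow_add, Real.mul_rpow (by positivity) (by positivity), ← Real.rpow_natCast,
              ← Real.rpow_natCast (2 ^ β), ← Real.rpow_mul (by norm_num),
              ← Real.rpow_mul (by norm_num), mul_comm β]
            norm_num
            ring
          have e2 : (2 * ((1 : ℝ) / 2) ^ n) ^ α = 2 ^ α * ((2 ^ α) ^ n)⁻¹ := by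
            rw [Real.mul_rpow (by norm_num) (by positivity), one_div, inv_pow,
              Real.inv_rpow (by positivity), ← Real.rpow_natCast, ← Real.rpow_natCast (2 ^ α),
              ← Real.rpow_mul (by norm_num), ← Real.rpow_mul (by norm_num), mul_comm α]
          rw [e1, e2, hρ, Real.rpow_sub (by norm_num), div_pow]
          ring
  calc _ ≤ ∫⁻ _, C ∂ν := lintegral_mono hbound
    _ < ∞ := by rw [lintegral_const]; exact ENNReal.mul_lt_top hCtop (measure_lt_top _ _)

/-- A set of dimension greater than `β` carries a measure of finite `β`-energy, supported on a
compact subset of small diameter. -/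
theorem exists_measure_energy_lt_top {A : Set ℝ} (hA : MeasurableSet A) {β : ℝ} (hβ : 0 < β)
    (hdim : ENNReal.ofReal β < dimH A) {r : ℝ} (hr : 0 < r) :
    ∃ (K : Set ℝ) (ν : Measure ℝ), K ⊆ A ∧ IsCompact K ∧ IsFiniteMeasure ν ∧ ν ≠ 0 ∧ ν Kᶜ = 0 ∧
      (∀ x ∈ K, ∀ y ∈ K, |x - y| ≤ r) ∧ ∫⁻ x, ∫⁻ y, edist x y ^ (-β) ∂ν ∂ν < ∞ := by
  obtain ⟨α, hβα, hα⟩ := ENNReal.lt_iff_exists_nnreal_btwn.1 hdim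
  rw [ENNReal.ofReal_lt_coe_iff hβ.le] at hβα
  obtain ⟨K, ν, hKA, hK, hfin, hν0, hνK, hν⟩ := exists_frostman_measure hA
    (by exact_mod_cast hβ.trans hβα) hα
  -- Some piece of length `r` has positive mass; a small diameter is wanted because correlations are
  -- controlled only for nearby points.
  have hcov : K ⊆ ⋃ j : ℤ, K ∩ Set.Icc (j * r) ((j + 1) * r) := by
    intro x hx
    refine Set.mem_iUnion.2 ⟨⌊x / r⌋, hx, ?_, ?_⟩
    · rw [← le_div_iff₀ hr]; exact Int.floor_le _
    · rw [← div_le_iff₀ hr]; exact (Int.lt_floor_add_one _).le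
  have hνKpos : ν K ≠ 0 := by
    intro h
    refine hν0 (Measure.measure_univ_eq_zero.1 ?_)
    rw [← Set.union_compl_self K]
    exact measure_union_null h hνK
  obtain ⟨j, hj⟩ : ∃ j : ℤ, ν (K ∩ Set.Icc (j * r) ((j + 1) * r)) ≠ 0 := by
    by_contra! hcon
    exact hνKpos (measure_mono_null hcov (measure_iUnion_null hcon))
  set K' := K ∩ Set.Icc (j * r) ((j + 1) * r) with hK'
  have hK'c : IsCompact K' := hK.inter_right isClosed_Icc
  refine ⟨K', ν.restrict K', Set.inter_subset_left.trans hKA, hK'c, inferInstance, ?_, ?_, ?_, ?_⟩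
  · rwa [Ne, Measure.restrict_eq_zero]
  · rw [Measure.restrict_apply hK'c.measurableSet.compl]; simp
  · rintro x ⟨-, hx1, hx2⟩ y ⟨-, hy1, hy2⟩
    rw [abs_le]
    exact ⟨by linarith, by linarith⟩
  · refine exists_bound_lintegral_edist hβ hβα fun x y hxy h1 => ?_
    exact (Measure.restrict_apply_le _ _).trans (hν x y hxy h1)

/-! ### Decay of the Bessel function `J₀` -/

/-- The Bessel function `J₀`, as an average over the circle. -/
noncomputable def besselZero (t : ℝ) : ℝ := ∫ θ in (0 : ℝ)..1, Real.cos (t * Real.cos (2 * Real.pi * θ))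

/-- The derivative of `J₀`. -/
noncomputable def besselZeroDeriv (t : ℝ) : ℝ :=
  ∫ θ in (0 : ℝ)..1, -(Real.cos (2 * Real.pi * θ) * Real.sin (t * Real.cos (2 * Real.pi * θ)))

/-- The second derivative of `J₀`. -/
noncomputable def besselZeroDerivTwo (t : ℝ) : ℝ :=
  ∫ θ in (0 : ℝ)..1, -(Real.cos (2 * Real.pi * θ) ^ 2 * Real.cos (t * Real.cos (2 * Real.pi * θ)))

lemma hasDerivAt_besselZero (t : ℝ) : HasDerivAt besselZero (besselZeroDeriv t) t := by
  refine (intervalIntegral.hasDerivAt_integral_of_dominated_loc_of_deriv_le (s := Set.univ)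
    (bound := fun _ => 1) (F := fun t θ => Real.cos (t * Real.cos (2 * Real.pi * θ)))
    (F' := fun t θ => -(Real.cos (2 * Real.pi * θ) * Real.sin (t * Real.cos (2 * Real.pi * θ))))
    Filter.univ_mem ?_ ?_ ?_ ?_ ?_ ?_).2
  · exact Eventually.of_forall fun s => Continuous.aestronglyMeasurable (by fun_prop)
  · exact Continuous.intervalIntegrable (by fun_prop) _ _
  · exact Continuous.aestronglyMeasurable (by fun_prop)
  · refine Eventually.of_forall fun θ _ s _ => ?_
    rw [norm_neg, norm_mul, Real.norm_eq_abs, Real.norm_eq_abs]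
    exact mul_le_one₀ (Real.abs_cos_le_one _) (abs_nonneg _) (Real.abs_sin_le_one _)
  · exact continuous_const.intervalIntegrable _ _
  · refine Eventually.of_forall fun θ _ s _ => ?_
    have h := ((hasDerivAt_id s).mul_const (Real.cos (2 * Real.pi * θ))).cos
    refine h.congr_deriv ?_
    simp only [id]
    ring

lemma hasDerivAt_besselZeroDeriv (t : ℝ) :
    HasDerivAt besselZeroDeriv (besselZeroDerivTwo t) t := by
  refine (intervalIntegral.hasDerivAt_integral_of_dominated_loc_of_deriv_le (s := Set.univ)
    (bound := fun _ => 1)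
    (F := fun t θ => -(Real.cos (2 * Real.pi * θ) * Real.sin (t * Real.cos (2 * Real.pi * θ))))
    (F' := fun t θ =>
      -(Real.cos (2 * Real.pi * θ) ^ 2 * Real.cos (t * Real.cos (2 * Real.pi * θ))))
    Filter.univ_mem ?_ ?_ ?_ ?_ ?_ ?_).2
  · exact Eventually.of_forall fun s => Continuous.aestronglyMeasurable (by fun_prop)
  · exact Continuous.intervalIntegrable (by fun_prop) _ _
  · exact Continuous.aestronglyMeasurable (by fun_prop)
  · refine Eventually.of_forall fun θ _ s _ => ?_
    rw [norm_neg, norm_mul, norm_pow, Real.norm_eq_abs, Real.norm_eq_abs]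
    exact mul_le_one₀ (pow_le_one₀ (abs_nonneg _) (Real.abs_cos_le_one _)) (abs_nonneg _)
      (Real.abs_cos_le_one _)
  · exact continuous_const.intervalIntegrable _ _
  · refine Eventually.of_forall fun θ _ s _ => ?_
    have h := ((((hasDerivAt_id s).mul_const (Real.cos (2 * Real.pi * θ))).sin).const_mul
      (Real.cos (2 * Real.pi * θ))).neg
    refine h.congr_deriv ?_
    simp only [id]
    ring

/-- Bessel's differential equation. -/
lemma besselZero_ode (t : ℝ) : t * (besselZero t + besselZeroDerivTwo t) = -besselZeroDeriv t := by
  have key : ∫ θ in (0 : ℝ)..1, (t * (Real.cos (t * Real.cos (2 * Real.pi * θ)) +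
      -(Real.cos (2 * Real.pi * θ) ^ 2 * Real.cos (t * Real.cos (2 * Real.pi * θ)))) +
      -(Real.cos (2 * Real.pi * θ) * Real.sin (t * Real.cos (2 * Real.pi * θ)))) = 0 := by
    -- The integrand is the derivative of a function that vanishes at both endpoints.
    have hderiv : ∀ θ ∈ Set.uIcc (0 : ℝ) 1, HasDerivAt (fun θ => -(2 * Real.pi)⁻¹ *
        (Real.sin (2 * Real.pi * θ) * Real.sin (t * Real.cos (2 * Real.pi * θ))))
        (t * (Real.cos (t * Real.cos (2 * Real.pi * θ)) +
      -(Real.cos (2 * Real.pi * θ) ^ 2 * Real.cos (t * Real.cos (2 * Real.pi * θ)))) +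
      -(Real.cos (2 * Real.pi * θ) * Real.sin (t * Real.cos (2 * Real.pi * θ)))) θ := by
      intro θ _
      have h0 : HasDerivAt (fun θ : ℝ => 2 * Real.pi * θ) (2 * Real.pi) θ := by
        simpa using (hasDerivAt_id θ).const_mul (2 * Real.pi)
      have h := (h0.sin.mul (h0.cos.const_mul t).sin).const_mul (-(2 * Real.pi)⁻¹)
      refine h.congr_deriv ?_
      have hs : Real.cos (2 * Real.pi * θ) ^ 2 = 1 - Real.sin (2 * Real.pi * θ) ^ 2 := by
        rw [← Real.sin_sq_add_cos_sq (2 * Real.pi * θ)]; ring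
      rw [hs]
      have := Real.pi_pos.ne'
      field_simp
      ring
    rw [intervalIntegral.integral_eq_sub_of_hasDerivAt hderiv
      (Continuous.intervalIntegrable (by fun_prop) _ _)]
    simp
  rw [intervalIntegral.integral_add (Continuous.intervalIntegrable (by fun_prop) _ _)
    (Continuous.intervalIntegrable (by fun_prop) _ _), intervalIntegral.integral_const_mul,
    intervalIntegral.integral_add (Continuous.intervalIntegrable (by fun_prop) _ _)
    (Continuous.intervalIntegrable (by fun_prop) _ _)] at key
  simp only [besselZero, besselZeroDeriv, besselZeroDerivTwo]
  linarith

/-- The energy F = t(J² + J'²) + JJ' satisfies F' = −JJ'/t by Bessel's equation, and F ≥ t(J² +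
J'²)/2 for t ≥ 1. Hence F' ≤ F/t², so F·exp(1/t) is nonincreasing and F stays bounded. -/
lemma exists_besselZero_sq_le : ∃ C : ℝ, 0 < C ∧ ∀ t, 1 ≤ t → besselZero t ^ 2 ≤ C / t := by
  set F : ℝ → ℝ := fun t =>
    t * (besselZero t ^ 2 + besselZeroDeriv t ^ 2) + besselZero t * besselZeroDeriv t with hF
  have hFd : ∀ t, 0 < t → HasDerivAt F (-(besselZero t * besselZeroDeriv t) / t) t := by
    intro t ht
    have h0 := hasDerivAt_besselZero t
    have h1 := hasDerivAt_besselZeroDeriv t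
    have h := ((hasDerivAt_id t).mul ((h0.pow 2).add (h1.pow 2))).add (h0.mul h1)
    refine h.congr_deriv ?_
    have hode := besselZero_ode t
    have h2 : besselZeroDeriv t = -(t * (besselZero t + besselZeroDerivTwo t)) := by linarith
    simp only [id, Pi.add_apply, Pi.pow_apply]
    rw [h2]
    field_simp
    ring
  have hFlow : ∀ t, 1 ≤ t → t * (besselZero t ^ 2 + besselZeroDeriv t ^ 2) / 2 ≤ F t := by
    intro t ht
    simp only [hF]
    nlinarith [sq_nonneg (besselZero t + besselZeroDeriv t), sq_nonneg (besselZero t),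
      sq_nonneg (besselZeroDeriv t)]
  set G : ℝ → ℝ := fun t => F t * Real.exp (1 / t) with hG
  have hGd : ∀ t, 0 < t → HasDerivAt G (-(besselZero t * besselZeroDeriv t) / t * Real.exp (1 / t) +
      F t * (Real.exp (1 / t) * (-1 / t ^ 2))) t := by
    intro t ht
    have h := (hFd t ht).mul ((hasDerivAt_inv ht.ne').exp)
    simp only [hG, one_div]
    exact h.congr_deriv (by ring)
  have hanti : AntitoneOn G (Set.Ici 1) := by
    refine antitoneOn_of_hasDerivWithinAt_nonpos (convex_Ici 1)
      (f' := fun t => -(besselZero t * besselZeroDeriv t) / t * Real.exp (1 / t) +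
      F t * (Real.exp (1 / t) * (-1 / t ^ 2)))
      (fun t ht => (hGd t (by linarith [Set.mem_Ici.1 ht])).continuousAt.continuousWithinAt) ?_ ?_
    · intro t ht
      rw [interior_Ici] at ht
      exact (hGd t (by linarith [Set.mem_Ioi.1 ht])).hasDerivWithinAt
    · intro t ht
      rw [interior_Ici] at ht
      have ht1 : 1 < t := ht
      have hl := hFlow t ht1.le
      have h2 : -(besselZero t * besselZeroDeriv t) * t ≤ F t := by
        refine le_trans ?_ hl
        nlinarith [sq_nonneg (besselZero t + besselZeroDeriv t)]
      have e : -(besselZero t * besselZeroDeriv t) / t * Real.exp (1 / t) +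
          F t * (Real.exp (1 / t) * (-1 / t ^ 2)) =
          (Real.exp (1 / t) / t ^ 2) * (-(besselZero t * besselZeroDeriv t) * t - F t) := by
        field_simp
        ring
      rw [e]
      exact mul_nonpos_of_nonneg_of_nonpos (by positivity) (by linarith)
  refine ⟨2 * |G 1| + 1, by positivity, fun t ht => ?_⟩
  have hFG : F t ≤ |G 1| := by
    have hF0 : 0 ≤ F t := le_trans (by positivity) (hFlow t ht)
    calc F t ≤ G t := le_mul_of_one_le_right hF0 (Real.one_le_exp (by positivity))
      _ ≤ G 1 := hanti Set.self_mem_Ici ht ht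
      _ ≤ |G 1| := le_abs_self _
  have := hFlow t ht
  rw [le_div_iff₀ (by linarith)]
  nlinarith [sq_nonneg (besselZeroDeriv t)]

/-- The variance of cos(t cos 2πθ) for uniform θ is nonnegative, and the double-angle formula
evaluates the mean square. -/
lemma besselZero_sq_le_double (t : ℝ) : besselZero t ^ 2 ≤ (1 + besselZero (2 * t)) / 2 := by
  set J := besselZero t with hJ
  have h0 : 0 ≤ ∫ θ in (0 : ℝ)..1, (Real.cos (t * Real.cos (2 * Real.pi * θ)) - J) ^ 2 :=
    intervalIntegral.integral_nonneg (by norm_num) fun _ _ => sq_nonneg _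
  have h1 : ∀ θ : ℝ, (Real.cos (t * Real.cos (2 * Real.pi * θ)) - J) ^ 2 =
      (1 / 2 + J ^ 2) + (1 / 2) * Real.cos (2 * t * Real.cos (2 * Real.pi * θ)) -
        2 * J * Real.cos (t * Real.cos (2 * Real.pi * θ)) := by
    intro θ
    rw [mul_assoc 2 t, Real.cos_two_mul]
    ring
  simp only [h1] at h0
  rw [intervalIntegral.integral_sub (Continuous.intervalIntegrable (by fun_prop) _ _)
    (Continuous.intervalIntegrable (by fun_prop) _ _), intervalIntegral.integral_add
    (Continuous.intervalIntegrable (by fun_prop) _ _)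
    (Continuous.intervalIntegrable (by fun_prop) _ _), intervalIntegral.integral_const_mul,
    intervalIntegral.integral_const_mul, intervalIntegral.integral_const] at h0
  have e1 : ∫ θ in (0 : ℝ)..1, Real.cos (t * Real.cos (2 * Real.pi * θ)) = J := rfl
  have e2 : ∫ θ in (0 : ℝ)..1, Real.cos (2 * t * Real.cos (2 * Real.pi * θ)) =
    besselZero (2 * t) := rfl
  rw [e1, e2] at h0
  simp only [sub_zero, one_smul] at h0
  nlinarith

/-- Decay gives a bound below 1 far out, and the doubling inequality carries such a bound from
[T/2^n, ∞) to [T/2^(n+1), ∞). -/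
lemma exists_abs_besselZero_le_of_one_le : ∃ ρ < 1, ∀ t, 1 ≤ t → |besselZero t| ≤ ρ := by
  obtain ⟨C, hC, hdec⟩ := exists_besselZero_sq_le
  set T := max 1 (4 * C) with hT
  have hind : ∀ n : ℕ, ∃ ρ < 1, ∀ t, T / 2 ^ n ≤ t → |besselZero t| ≤ ρ := by
    intro n
    induction n with
    | zero =>
      refine ⟨1 / 2, by norm_num, fun t ht => ?_⟩
      rw [pow_zero, div_one] at ht
      have h1 : 1 ≤ t := (le_max_left _ _).trans ht
      have h2 : 4 * C ≤ t := (le_max_right _ _).trans ht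
      refine abs_le_of_sq_le_sq ((hdec t h1).trans ?_) (by norm_num)
      rw [div_le_iff₀ (by linarith)]
      linarith
    | succ n ih =>
      obtain ⟨ρ, hρ, h⟩ := ih
      refine ⟨Real.sqrt ((1 + ρ) / 2), ?_, fun t ht => ?_⟩
      · rw [Real.sqrt_lt' one_pos]; linarith
      · refine Real.abs_le_sqrt ((besselZero_sq_le_double t).trans ?_)
        have := (le_abs_self _).trans (h (2 * t) (by
          rw [pow_succ, ← div_div, div_le_iff₀ (by norm_num)] at ht; linarith))
        linarith
  obtain ⟨n, hn⟩ := pow_unbounded_of_one_lt T (by norm_num : (1 : ℝ) < 2)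
  obtain ⟨ρ, hρ, h⟩ := hind n
  refine ⟨ρ, hρ, fun t ht => h t (le_trans ?_ ht)⟩
  rw [div_le_one (by positivity)]
  exact hn.le

/-- Average cos u ≤ 1 − 2u²/π² over the circle, where cos² has mean 1/2; for t ≤ 1 the integrand is
nonnegative, so the absolute value is harmless. -/
lemma abs_besselZero_le_of_le_one {t : ℝ} (h0 : 0 ≤ t) (h1 : t ≤ 1) :
    |besselZero t| ≤ 1 - t ^ 2 / Real.pi ^ 2 := by
  have hb : ∀ θ : ℝ, |t * Real.cos (2 * Real.pi * θ)| ≤ 1 := fun θ => by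
    rw [abs_mul, abs_of_nonneg h0]
    exact mul_le_one₀ h1 (abs_nonneg _) (Real.abs_cos_le_one _)
  have hnn : 0 ≤ besselZero t := intervalIntegral.integral_nonneg (by norm_num) fun θ _ => by
    have := abs_le.1 (hb θ)
    have hp := Real.pi_gt_three
    exact Real.cos_nonneg_of_mem_Icc ⟨by linarith, by linarith⟩
  rw [abs_of_nonneg hnn]
  calc besselZero t ≤ ∫ θ in (0 : ℝ)..1,
        ((1 - t ^ 2 / Real.pi ^ 2) - t ^ 2 / Real.pi ^ 2 * Real.cos (4 * Real.pi * θ)) := by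
        refine intervalIntegral.integral_mono_on (by norm_num)
          (Continuous.intervalIntegrable (by fun_prop) _ _)
          (Continuous.intervalIntegrable (by fun_prop) _ _) fun θ _ => ?_
        refine (Real.cos_le_one_sub_mul_cos_sq ((hb θ).trans ?_)).trans (le_of_eq ?_)
        · linarith [Real.pi_gt_three]
        · rw [show 4 * Real.pi * θ = 2 * (2 * Real.pi * θ) by ring, Real.cos_two_mul]
          field_simp
          ring
    _ = 1 - t ^ 2 / Real.pi ^ 2 := by
        rw [intervalIntegral.integral_sub (Continuous.intervalIntegrable (by fun_prop) _ _)
          (Continuous.intervalIntegrable (by fun_prop) _ _), intervalIntegral.integral_const_mul,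
          intervalIntegral.integral_const]
        have : ∫ θ in (0 : ℝ)..1, Real.cos (4 * Real.pi * θ) = 0 := by
          rw [intervalIntegral.integral_comp_mul_left (fun x => Real.cos x)
            (by positivity : 4 * Real.pi ≠ 0), integral_cos]
          have : Real.sin (4 * Real.pi) = 0 := by
            simpa using Real.sin_nat_mul_pi 4
          simp [this]
        rw [this]
        simp

/-- Power decay of `J₀`, with a bound valid for all arguments and sharp at the origin. -/
theorem exists_abs_besselZero_le :
    ∃ κ : ℝ, 0 < κ ∧ ∀ t, 0 ≤ t → |besselZero t| ≤ (1 + t ^ 2) ^ (-κ) := by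
  obtain ⟨C, hC, hdec⟩ := exists_besselZero_sq_le
  obtain ⟨ρ, hρ1, hρ⟩ := exists_abs_besselZero_le_of_one_le
  have hρ0 : 0 ≤ ρ := (abs_nonneg _).trans (hρ 1 le_rfl)
  -- Beyond `T` one has C ≤ √t and 1 + t² ≤ t³, hence J₀² ≤ t^(-1/2) ≤ (1 + t²)^(-1/6), which is the
  -- source of 1/12 below.
  set T := max 2 (C ^ 2) with hT
  have hT2 : 2 ≤ T := le_max_left _ _
  -- On [1, T] a constant bound below 1 suffices, as (1 + T²)^(-κ) tends to 1 when κ tends to 0.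
  obtain ⟨κ₂, hκ₂, hκ₂ρ⟩ : ∃ κ₂ : ℝ, 0 < κ₂ ∧ ρ ≤ (1 + T ^ 2) ^ (-κ₂) := by
    have hlim : Tendsto (fun κ : ℝ => (1 + T ^ 2) ^ (-κ)) (nhdsWithin 0 (Set.Ioi 0)) (nhds 1) := by
      have hc : Continuous fun κ : ℝ => (1 + T ^ 2) ^ (-κ) :=
        Real.continuous_const_rpow (by positivity) |>.comp continuous_neg
      have := hc.tendsto 0
      rw [neg_zero, Real.rpow_zero] at this
      exact this.mono_left nhdsWithin_le_nhds
    obtain ⟨κ, hκ1, hκ2⟩ := ((hlim.eventually (lt_mem_nhds hρ1)).and self_mem_nhdsWithin).exists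
    exact ⟨κ, hκ2, hκ1.le⟩
  set κ := min (min (1 / 12) κ₂) (1 / Real.pi ^ 2) with hκ
  have hκ0 : 0 < κ := lt_min (lt_min (by norm_num) hκ₂) (by positivity)
  refine ⟨κ, hκ0, fun t ht => ?_⟩
  have hbase : 1 ≤ 1 + t ^ 2 := by linarith [sq_nonneg t]
  rcases le_total t 1 with h1 | h1
  · calc |besselZero t| ≤ 1 - t ^ 2 / Real.pi ^ 2 := abs_besselZero_le_of_le_one ht h1
      _ ≤ Real.exp (-(t ^ 2 / Real.pi ^ 2)) := by
        linarith [Real.add_one_le_exp (-(t ^ 2 / Real.pi ^ 2))]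
      _ ≤ (1 + t ^ 2) ^ (-κ) := by
        rw [Real.rpow_def_of_pos (by linarith), Real.exp_le_exp]
        have hl : Real.log (1 + t ^ 2) ≤ t ^ 2 := by
          linarith [Real.log_le_sub_one_of_pos (show 0 < 1 + t ^ 2 by linarith)]
        have hl0 : 0 ≤ Real.log (1 + t ^ 2) := Real.log_nonneg hbase
        have hk : κ ≤ 1 / Real.pi ^ 2 := min_le_right _ _
        have : Real.log (1 + t ^ 2) * κ ≤ t ^ 2 * (1 / Real.pi ^ 2) :=
          mul_le_mul hl hk hκ0.le (by positivity)
        rw [mul_one_div] at this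
        linarith
  rcases le_total t T with hT' | hT'
  · calc |besselZero t| ≤ ρ := hρ t h1
      _ ≤ (1 + T ^ 2) ^ (-κ₂) := hκ₂ρ
      _ ≤ (1 + t ^ 2) ^ (-κ₂) := by
        refine Real.rpow_le_rpow_of_nonpos (by positivity) (by gcongr) (by linarith)
      _ ≤ (1 + t ^ 2) ^ (-κ) := by
        refine Real.rpow_le_rpow_of_exponent_le hbase (neg_le_neg ?_)
        exact (min_le_left _ _).trans (min_le_right _ _)
  · have ht2 : 2 ≤ t := hT2.trans hT'
    have htC : C ^ 2 ≤ t := (le_max_right _ _).trans hT'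
    have hst : C ≤ Real.sqrt t := Real.le_sqrt_of_sq_le htC
    have hJ : besselZero t ^ 2 ≤ ((1 + t ^ 2) ^ (-(1 / 12) : ℝ)) ^ 2 := by
      calc besselZero t ^ 2 ≤ C / t := hdec t h1
        _ ≤ Real.sqrt t / t := by gcongr
        _ = t ^ (-(1 / 2) : ℝ) := by
          rw [Real.sqrt_div_self, Real.sqrt_eq_rpow, Real.rpow_neg (by linarith), one_div]
        _ = (t ^ 3) ^ (-(1 / 6) : ℝ) := by
          rw [← Real.rpow_natCast, ← Real.rpow_mul (by linarith)]; norm_num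
        _ ≤ (1 + t ^ 2) ^ (-(1 / 6) : ℝ) := by
          refine Real.rpow_le_rpow_of_nonpos (by positivity) ?_ (by norm_num)
          nlinarith [sq_nonneg t]
        _ = _ := by
          rw [← Real.rpow_natCast ((1 + t ^ 2) ^ (-(1 / 12) : ℝ)), ← Real.rpow_mul (by positivity)]
          norm_num
    calc |besselZero t| ≤ (1 + t ^ 2) ^ (-(1 / 12) : ℝ) :=
          abs_le_of_sq_le_sq hJ (by positivity)
      _ ≤ (1 + t ^ 2) ^ (-κ) := by
        refine Real.rpow_le_rpow_of_exponent_le hbase (neg_le_neg ?_)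
        exact (min_le_left _ _).trans (min_le_left _ _)

/-! ### Characters of the plane and circle averages -/

/-- The character `u ↦ exp (-2πi ⟨ξ, u⟩)` of the plane. -/
noncomputable def planeChar (ξ u : ℂ) : ℂ :=
  Complex.exp (-2 * (Real.pi : ℂ) * Complex.I * ((inner ℝ ξ u : ℝ) : ℂ))

lemma planeChar_eq (ξ u : ℂ) :
    planeChar ξ u = Complex.exp (((-2 * Real.pi * inner ℝ ξ u : ℝ) : ℂ) * Complex.I) := by
  rw [planeChar]; push_cast; ring_nf

@[simp] lemma norm_planeChar (ξ u : ℂ) : ‖planeChar ξ u‖ = 1 := by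
  rw [planeChar_eq, Complex.norm_exp_ofReal_mul_I]

lemma planeChar_add (ξ u v : ℂ) : planeChar ξ (u + v) = planeChar ξ u * planeChar ξ v := by
  rw [planeChar, planeChar, planeChar, ← Complex.exp_add, inner_add_right]
  push_cast; ring_nf

lemma planeChar_zero (ξ : ℂ) : planeChar ξ 0 = 1 := by simp [planeChar]

lemma planeChar_sub (ξ u v : ℂ) :
    planeChar ξ (u - v) = planeChar ξ u * (starRingEnd ℂ) (planeChar ξ v) := by
  rw [planeChar_eq ξ v, ← Complex.exp_conj, planeChar, planeChar, ← Complex.exp_add, inner_sub_right]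
  simp only [map_mul, Complex.conj_ofReal, Complex.conj_I]
  push_cast; ring_nf

lemma planeChar_sum {ι : Type*} (ξ : ℂ) (F : Finset ι) (u : ι → ℂ) :
    planeChar ξ (∑ i ∈ F, u i) = ∏ i ∈ F, planeChar ξ (u i) := by
  classical
  induction F using Finset.induction_on with
  | empty => simp [planeChar_zero]
  | insert i F hi ih => rw [Finset.sum_insert hi, Finset.prod_insert hi, planeChar_add, ih]

lemma continuous_planeChar : Continuous fun p : ℂ × ℂ => planeChar p.1 p.2 := by
  unfold planeChar
  fun_prop

lemma inner_mul_exp (ξ w : ℂ) (θ : ℝ) :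
    inner ℝ ξ (w * Complex.exp (2 * (Real.pi : ℂ) * Complex.I * (θ : ℂ))) =
      ‖ξ‖ * ‖w‖ * Real.cos (2 * Real.pi * (θ + Complex.arg ((starRingEnd ℂ) ξ * w) / (2 * Real.pi))) := by
  set z := (starRingEnd ℂ) ξ * w with hz
  have h1 : inner ℝ ξ (w * Complex.exp (2 * (Real.pi : ℂ) * Complex.I * (θ : ℂ))) =
      (z * Complex.exp (2 * (Real.pi : ℂ) * Complex.I * (θ : ℂ))).re := by
    rw [Complex.inner, hz]
    congr 1
    ring
  have h2 : ‖ξ‖ * ‖w‖ = ‖z‖ := by rw [hz, norm_mul, Complex.norm_conj]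
  have hpi := Real.pi_pos.ne'
  rw [h1, h2]
  conv_lhs => rw [← Complex.norm_mul_exp_arg_mul_I z]
  rw [mul_assoc, ← Complex.exp_add, Complex.re_ofReal_mul]
  rw [show (Complex.arg z : ℂ) * Complex.I + 2 * (Real.pi : ℂ) * Complex.I * (θ : ℂ) =
    ((2 * Real.pi * (θ + Complex.arg z / (2 * Real.pi)) : ℝ) : ℂ) * Complex.I by
      push_cast
      field_simp
      ring]
  rw [Complex.exp_ofReal_mul_I_re]

/-- A shift of θ by half a period reverses the sign of the integrand. -/
lemma integral_sin_mul_cos_eq_zero (t : ℝ) :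
    ∫ θ in (0 : ℝ)..1, Real.sin (t * Real.cos (2 * Real.pi * θ)) = 0 := by
  set f : ℝ → ℝ := fun θ => Real.sin (t * Real.cos (2 * Real.pi * θ)) with hf
  have hper : Function.Periodic f 1 := by
    intro θ
    simp only [hf]
    rw [mul_add, mul_one, Real.cos_add_two_pi]
  have h1 : ∫ θ in (0 : ℝ)..1, f (θ + 1 / 2) = ∫ θ in (0 : ℝ)..1, f θ := by
    rw [intervalIntegral.integral_comp_add_right, add_comm 1, zero_add]
    simpa using hper.intervalIntegral_add_eq (1 / 2) 0
  have h2 : ∀ θ, f (θ + 1 / 2) = -f θ := by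
    intro θ
    simp only [hf]
    rw [show 2 * Real.pi * (θ + 1 / 2) = 2 * Real.pi * θ + Real.pi by ring, Real.cos_add_pi,
      mul_neg, Real.sin_neg]
  simp only [h2, intervalIntegral.integral_neg] at h1
  linarith

/-- The average of a character over a circle centred at the origin is a value of `J₀`. -/
lemma integral_planeChar_circle (ξ w : ℂ) :
    ∫ θ in (0 : ℝ)..1, planeChar ξ (w * Complex.exp (2 * (Real.pi : ℂ) * Complex.I * (θ : ℂ))) =
      besselZero (2 * Real.pi * ‖ξ‖ * ‖w‖) := by
  set c := Complex.arg ((starRingEnd ℂ) ξ * w) / (2 * Real.pi) with hc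
  set t := 2 * Real.pi * ‖ξ‖ * ‖w‖ with ht
  set g : ℝ → ℂ := fun θ => Complex.exp (((-(t * Real.cos (2 * Real.pi * θ)) : ℝ) : ℂ) * Complex.I)
    with hg
  have h1 : ∀ θ : ℝ, planeChar ξ (w * Complex.exp (2 * (Real.pi : ℂ) * Complex.I * (θ : ℂ))) =
      g (θ + c) := by
    intro θ
    rw [planeChar_eq, inner_mul_exp, hg]
    congr 3
    rw [ht, hc]
    ring
  have hper : Function.Periodic g 1 := by
    intro θ
    simp only [hg]
    rw [mul_add, mul_one, Real.cos_add_two_pi]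
  simp only [h1]
  rw [intervalIntegral.integral_comp_add_right, zero_add, add_comm 1 c,
    hper.intervalIntegral_add_eq c 0, zero_add]
  have h2 : ∀ θ, g θ = ((Real.cos (t * Real.cos (2 * Real.pi * θ)) : ℝ) : ℂ) -
      ((Real.sin (t * Real.cos (2 * Real.pi * θ)) : ℝ) : ℂ) * Complex.I := by
    intro θ
    simp only [hg]
    rw [Complex.exp_mul_I, ← Complex.ofReal_cos, ← Complex.ofReal_sin, Real.cos_neg, Real.sin_neg]
    push_cast
    ring
  simp only [h2]
  rw [intervalIntegral.integral_sub (Continuous.intervalIntegrable (by fun_prop) _ _)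
    (Continuous.intervalIntegrable (by fun_prop) _ _), intervalIntegral.integral_mul_const,
    intervalIntegral.integral_ofReal, intervalIntegral.integral_ofReal,
    integral_sin_mul_cos_eq_zero]
  simp [besselZero]

/-! ### Lower bounds for the blocks of coefficients -/

/-- A limsup below τ constrains every late block, not just infinitely many; a vanishing block would
make the quotient `⊤`. -/
lemma eventually_rpow_lt_blockNorm {q : ℝ} (hq : 1 < q) {lam : ℕ → ℝ} {a : ℕ → ℂ} {τ : ℝ}
    (h : decayExponent q lam a < (τ : EReal)) :
    ∀ᶠ k : ℕ in atTop, (q ^ k) ^ (-τ) < blockNorm q lam a k := by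
  have hlq := Real.log_pos hq
  filter_upwards [eventually_lt_of_limsup_lt h, eventually_ge_atTop 1] with k hk hk1
  have hk0 : (0 : ℝ) < k * Real.log q := by
    have : (1 : ℝ) ≤ k := by exact_mod_cast hk1
    positivity
  rcases le_or_gt (blockNorm q lam a k) 0 with h0 | h0
  · rw [ENNReal.log_ofReal, if_pos h0, EReal.neg_bot, EReal.top_div_of_pos_ne_top
      (by exact_mod_cast hk0) (EReal.coe_ne_top _)] at hk
    exact absurd hk not_top_lt
  · rw [ENNReal.log_ofReal_of_pos h0, ← EReal.coe_neg, ← EReal.coe_div, EReal.coe_lt_coe_iff,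
      div_lt_iff₀ hk0] at hk
    rw [← Real.log_lt_log_iff (by positivity) h0, Real.log_rpow (by positivity), Real.log_pow]
    linarith

lemma exists_finset_block {q : ℝ} (hq : 1 < q) {lam : ℕ → ℝ} {a : ℕ → ℂ} {τ : ℝ}
    (h : decayExponent q lam a < (τ : EReal)) :
    ∃ k₀ : ℕ, ∀ k ≥ k₀, ∃ F : Finset ℕ, (∀ n ∈ F, q ^ k ≤ lam n ∧ lam n < q ^ (k + 1)) ∧
      ((q ^ k) ^ (-τ)) ^ 2 ≤ ∑ n ∈ F, ‖a n‖ ^ 2 := by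
  classical
  obtain ⟨k₀, hk₀⟩ := eventually_atTop.1 (eventually_rpow_lt_blockNorm hq h)
  refine ⟨k₀, fun k hk => ?_⟩
  have h1 := hk₀ k hk
  have hpos : 0 ≤ (q ^ k) ^ (-τ) := by positivity
  rw [blockNorm, Real.lt_sqrt hpos] at h1
  set f : ℕ → ℝ := fun n => if q ^ k ≤ lam n ∧ lam n < q ^ (k + 1) then ‖a n‖ ^ 2 else 0 with hf
  -- A divergent sum would have the default value 0, contradicting the strict lower bound.
  have hsum : Summable f := by
    by_contra hns
    have h2 : ((q ^ k) ^ (-τ)) ^ 2 < ∑' n, f n := by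
      simpa only [hf] using h1
    rw [tsum_eq_zero_of_not_summable hns] at h2
    exact absurd h2 (not_lt.2 (sq_nonneg _))
  have h2 : ((q ^ k) ^ (-τ)) ^ 2 < ∑' n, f n := by
    simpa only [hf] using h1
  obtain ⟨F, hF⟩ := (hsum.hasSum.eventually (lt_mem_nhds h2)).exists
  refine ⟨F.filter fun n => q ^ k ≤ lam n ∧ lam n < q ^ (k + 1), fun n hn =>
    (Finset.mem_filter.1 hn).2, ?_⟩
  rw [Finset.sum_filter]
  exact hF.le

lemma one_add_sum_le_prod {ι : Type*} (F : Finset ι) {f : ι → ℝ} (hf : ∀ i, 0 ≤ f i) :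
    1 + ∑ i ∈ F, f i ≤ ∏ i ∈ F, (1 + f i) := by
  classical
  induction F using Finset.induction_on with
  | empty => simp
  | insert i F hi ih =>
    rw [Finset.sum_insert hi, Finset.prod_insert hi]
    have h1 : 0 ≤ ∑ i ∈ F, f i := Finset.sum_nonneg fun i _ => hf i
    nlinarith [hf i, mul_nonneg (hf i) h1]

/-- Since the bound on J₀ is valid down to t = 0, many small arguments accumulate: only their ℓ²
size matters, not their number. -/
lemma prod_abs_besselZero_le {ι : Type*} {κ : ℝ} (hκ : 0 < κ)
    (hJ : ∀ t, 0 ≤ t → |besselZero t| ≤ (1 + t ^ 2) ^ (-κ)) (F : Finset ι) {t : ι → ℝ}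
    (ht : ∀ i, 0 ≤ t i) {B : ℝ} (hB : B ^ 2 ≤ ∑ i ∈ F, t i ^ 2) :
    ∏ i ∈ F, |besselZero (t i)| ≤ (1 + B ^ 2) ^ (-κ) := by
  calc ∏ i ∈ F, |besselZero (t i)| ≤ ∏ i ∈ F, (1 + t i ^ 2) ^ (-κ) :=
        Finset.prod_le_prod (fun _ _ => abs_nonneg _) fun i _ => hJ _ (ht i)
    _ = (∏ i ∈ F, (1 + t i ^ 2)) ^ (-κ) :=
        Real.finsetProd_rpow _ _ (fun i _ => by positivity) _
    _ ≤ (1 + B ^ 2) ^ (-κ) := by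
        refine Real.rpow_le_rpow_of_nonpos (by positivity) ?_ (by linarith)
        exact (by linarith : 1 + B ^ 2 ≤ 1 + ∑ i ∈ F, t i ^ 2).trans
          (one_add_sum_le_prod F fun i => sq_nonneg _)

/-- Finitely many consecutive blocks give a power decay of arbitrarily high order. -/
theorem exists_prod_besselZero_le {κ : ℝ} (hκ : 0 < κ)
    (hJ : ∀ t, 0 ≤ t → |besselZero t| ≤ (1 + t ^ 2) ^ (-κ))
    {φ : ℕ → ℝ → ℂ} {L δ : ℝ} (hL : 1 ≤ L) (hδ : 0 < δ)
    (hφ : ∀ n x y, |x - y| ≤ δ → L⁻¹ * |x - y| ≤ ‖φ n x - φ n y‖)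
    {a : ℕ → ℂ} {lam : ℕ → ℝ} {q : ℝ} (hq : 1 < q) {τ : ℝ} (hτ0 : 0 < τ)
    (hτ : decayExponent q lam a < (τ : EReal)) (m : ℕ) :
    ∃ r₀ > 0, ∃ b > 0, ∀ x y, x ≠ y → |x - y| ≤ r₀ → ∃ F : Finset ℕ, ∀ u, 0 ≤ u →
      ∏ n ∈ F, |besselZero (2 * Real.pi * u * ‖a n * (φ n (lam n * x) - φ n (lam n * y))‖)| ≤
        (1 + (b * |x - y| ^ τ * u) ^ 2) ^ (-(κ * m)) := by
  classical
  obtain ⟨k₀, hk₀⟩ := exists_finset_block hq hτ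
  have hq0 : 0 < q := by linarith
  have hL0 : 0 < L := by linarith
  -- The radius leaves room for m blocks beyond `k₀` below scale δ/r. In b, the factor L⁻¹δ/q^(m+1)
  -- bounds the increments of φ_n from below and δ^(-τ) comes from Q ≤ δ/r.
  refine ⟨δ / q ^ (k₀ + m), by positivity, L⁻¹ * (δ / q ^ (m + 1) / δ ^ τ), by positivity,
    fun x y hxy hr => ?_⟩
  set r := |x - y| with hrdef
  have hr0 : 0 < r := abs_pos.2 (sub_ne_zero.2 hxy)
  have hbig : q ^ (k₀ + m) ≤ δ / r := by
    rw [le_div_iff₀ hr0]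
    rw [le_div_iff₀ (by positivity)] at hr
    linarith
  obtain ⟨N, hN1, hN2⟩ := exists_nat_pow_near ((one_le_pow₀ hq.le).trans hbig) hq
  have hNm : k₀ + m ≤ N := by
    have := (pow_lt_pow_iff_right₀ hq).1 (hbig.trans_lt hN2)
    omega
  -- The blocks used are N − m, …, N − 1, where q^N ≤ δ/r < q^(N+1): stopping at N − 1 keeps λ_n r ≤
  -- δ, and starting at N − m keeps λ_n r ≥ δ/q^(m+1).
  have hex : ∀ i : ℕ, ∃ F : Finset ℕ, (∀ n ∈ F, q ^ (N - m + i) ≤ lam n ∧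
      lam n < q ^ (N - m + i + 1)) ∧
      ((q ^ (N - m + i)) ^ (-τ)) ^ 2 ≤ ∑ n ∈ F, ‖a n‖ ^ 2 := fun i => hk₀ _ (by omega)
  choose F hFmem hFsum using hex
  have hdisj : Set.PairwiseDisjoint (↑(Finset.range m)) F := by
    have key : ∀ i j, i < j → Disjoint (F i) (F j) := by
      intro i j hij
      rw [Finset.disjoint_left]
      intro n hni hnj
      have h1 := (hFmem i n hni).2
      have h2 := (hFmem j n hnj).1
      have h3 : q ^ (N - m + i + 1) ≤ q ^ (N - m + j) := pow_le_pow_right₀ hq.le (by omega)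
      linarith
    intro i _ j _ hij
    rcases lt_or_gt_of_ne hij with h | h
    · exact key i j h
    · exact (key j i h).symm
  refine ⟨(Finset.range m).biUnion F, fun u hu => ?_⟩
  rw [Finset.prod_biUnion hdisj]
  set B := L⁻¹ * (δ / q ^ (m + 1) / δ ^ τ) * r ^ τ * u with hB
  have hblock : ∀ i ∈ Finset.range m, ∏ n ∈ F i,
      |besselZero (2 * Real.pi * u * ‖a n * (φ n (lam n * x) - φ n (lam n * y))‖)| ≤
        (1 + B ^ 2) ^ (-κ) := by
    intro i hi
    rw [Finset.mem_range] at hi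
    refine prod_abs_besselZero_le hκ hJ (F i) (fun n => by positivity) ?_
    set Q := q ^ (N - m + i) with hQ
    have hQ0 : 0 < Q := by positivity
    have hQle : Q ≤ δ / r := (pow_le_pow_right₀ hq.le (by omega)).trans hN1
    have hQge : δ / q ^ (m + 1) ≤ Q * r := by
      rw [div_le_iff₀ (by positivity), mul_assoc, mul_comm r, ← mul_assoc, hQ, ← pow_add]
      have h1 : δ ≤ q ^ (N + 1) * r := by
        rw [← div_le_iff₀ hr0]; exact hN2.le
      exact h1.trans (mul_le_mul_of_nonneg_right (pow_le_pow_right₀ hq.le (by omega)) hr0.le)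
    have hQτ : r ^ τ / δ ^ τ ≤ Q ^ (-τ) := by
      rw [← Real.div_rpow hr0.le hδ.le, Real.rpow_neg hQ0.le, ← Real.inv_rpow hQ0.le]
      refine Real.rpow_le_rpow (by positivity) ?_ hτ0.le
      rw [le_inv_comm₀ (by positivity) hQ0, inv_div]
      exact hQle
    have hBle : B ≤ u * (L⁻¹ * (Q * r)) * Q ^ (-τ) := by
      calc B = u * (L⁻¹ * (δ / q ^ (m + 1))) * (r ^ τ / δ ^ τ) := by rw [hB]; ring
        _ ≤ _ := by gcongr
    have hB0 : 0 ≤ B := by positivity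
    have hterm : ∀ n ∈ F i, (u * (L⁻¹ * (Q * r))) ^ 2 * ‖a n‖ ^ 2 ≤
        (2 * Real.pi * u * ‖a n * (φ n (lam n * x) - φ n (lam n * y))‖) ^ 2 := by
      intro n hn
      obtain ⟨h1, h2⟩ := hFmem i n hn
      have hlam0 : 0 < lam n := hQ0.trans_le h1
      have habs : |lam n * x - lam n * y| = lam n * r := by
        rw [← mul_sub, abs_mul, abs_of_pos hlam0]
      have hsmall : |lam n * x - lam n * y| ≤ δ := by
        rw [habs, ← le_div_iff₀ hr0]
        refine h2.le.trans ((pow_le_pow_right₀ hq.le ?_).trans hN1)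
        omega
      have hd := hφ n _ _ hsmall
      rw [habs] at hd
      have hd2 : L⁻¹ * (Q * r) ≤ ‖φ n (lam n * x) - φ n (lam n * y)‖ := by
        refine le_trans ?_ hd
        gcongr
      rw [← mul_pow, norm_mul]
      refine pow_le_pow_left₀ (by positivity) ?_ 2
      have hpi : 1 ≤ 2 * Real.pi := by linarith [Real.pi_gt_three]
      calc u * (L⁻¹ * (Q * r)) * ‖a n‖
          ≤ 1 * u * (‖a n‖ * ‖φ n (lam n * x) - φ n (lam n * y)‖) := by
            rw [one_mul, mul_assoc, mul_comm _ ‖a n‖]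
            gcongr
        _ ≤ _ := by gcongr
    calc B ^ 2 ≤ (u * (L⁻¹ * (Q * r)) * Q ^ (-τ)) ^ 2 := by gcongr
      _ = (u * (L⁻¹ * (Q * r))) ^ 2 * (Q ^ (-τ)) ^ 2 := mul_pow _ _ _
      _ ≤ (u * (L⁻¹ * (Q * r))) ^ 2 * ∑ n ∈ F i, ‖a n‖ ^ 2 := by
          gcongr
          exact hFsum i
      _ = ∑ n ∈ F i, (u * (L⁻¹ * (Q * r))) ^ 2 * ‖a n‖ ^ 2 := Finset.mul_sum _ _ _
      _ ≤ _ := Finset.sum_le_sum hterm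
  calc _ ≤ ∏ i ∈ Finset.range m, (1 + B ^ 2) ^ (-κ) :=
        Finset.prod_le_prod (fun i _ => Finset.prod_nonneg fun _ _ => abs_nonneg _) hblock
    _ = _ := by
        rw [Finset.prod_const, Finset.card_range, ← Real.rpow_natCast, ← Real.rpow_mul (by positivity),
          neg_mul]

/-! ### Radial integrals in the plane -/

/-- In polar coordinates the integrand is y^(s-1)(1 + y²)^(-N): s > 0 gives convergence at 0 and s <
2N at infinity. -/
lemma lintegral_radial_lt_top {s N : ℝ} (hs : 0 < s) (hN : s < 2 * N) :
    ∫⁻ ξ : ℂ, ENNReal.ofReal (‖ξ‖ ^ (s - 2) * (1 + ‖ξ‖ ^ 2) ^ (-N)) < ∞ := by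
  have hN0 : 0 < N := by linarith
  set f : ℝ → ℝ := fun y => y ^ (s - 2) * (1 + y ^ 2) ^ (-N) with hf
  have hfm : Measurable f := by fun_prop
  have hint : Integrable (fun ξ : ℂ => f ‖ξ‖) := by
    rw [integrable_fun_norm_addHaar volume (f := f), Complex.finrank_real_complex]
    have e : ∀ y ∈ Set.Ioi (0 : ℝ), y ^ (s - 1) * (1 + y ^ 2) ^ (-N) = y ^ (2 - 1) • f y := by
      intro y hy
      have hy0 : 0 < y := hy
      rw [hf, smul_eq_mul, ← mul_assoc, show s - 1 = 1 + (s - 2) by ring, Real.rpow_add hy0,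
        Real.rpow_one]
      norm_num
    refine IntegrableOn.congr_fun ?_ e measurableSet_Ioi
    have hm : Measurable fun y : ℝ => y ^ (s - 1) * (1 + y ^ 2) ^ (-N) := by fun_prop
    rw [← Set.Ioo_union_Ici_eq_Ioi (zero_lt_one' ℝ)]
    refine IntegrableOn.union ?_ ?_
    · have h1 : IntegrableOn (fun y : ℝ => y ^ (s - 1)) (Set.Ioo 0 1) :=
        (intervalIntegral.integrableOn_Ioo_rpow_iff one_pos).2 (by linarith)
      refine Integrable.mono' h1 hm.aestronglyMeasurable ?_
      filter_upwards [ae_restrict_mem measurableSet_Ioo] with y hy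
      have hy0 : 0 < y := hy.1
      rw [Real.norm_of_nonneg (by positivity)]
      refine mul_le_of_le_one_right (by positivity) ?_
      exact Real.rpow_le_one_of_one_le_of_nonpos (by linarith [sq_nonneg y]) (by linarith)
    · rw [integrableOn_Ici_iff_integrableOn_Ioi]
      have h1 : IntegrableOn (fun y : ℝ => y ^ (s - 1 - 2 * N)) (Set.Ioi 1) :=
        integrableOn_Ioi_rpow_of_lt (by linarith) one_pos
      refine Integrable.mono' h1 hm.aestronglyMeasurable ?_
      filter_upwards [ae_restrict_mem measurableSet_Ioi] with y hy
      have hy0 : 0 < y := zero_lt_one.trans hy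
      rw [Real.norm_of_nonneg (by positivity), sub_eq_add_neg (s - 1), Real.rpow_add hy0]
      refine mul_le_mul_of_nonneg_left ?_ (by positivity)
      rw [show -(2 * N) = 2 * (-N) by ring, Real.rpow_mul hy0.le, Real.rpow_ofNat]
      exact Real.rpow_le_rpow_of_nonpos (by positivity) (by linarith) (by linarith)
  have := hint.lintegral_lt_top
  simpa only [hf] using this

/-- Substitute Rξ for ξ. With R = b|x − y|^τ, the factor R^(-s) becomes the Riesz kernel of order
sτ. -/
lemma lintegral_radial_scale {s N R : ℝ} (hR : 0 < R) :
    ∫⁻ ξ : ℂ, ENNReal.ofReal (‖ξ‖ ^ (s - 2) * (1 + (R * ‖ξ‖) ^ 2) ^ (-N)) =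
      ENNReal.ofReal (R ^ (-s)) *
        ∫⁻ ξ : ℂ, ENNReal.ofReal (‖ξ‖ ^ (s - 2) * (1 + ‖ξ‖ ^ 2) ^ (-N)) := by
  have hm : Measurable fun ξ : ℂ => ENNReal.ofReal (‖ξ‖ ^ (s - 2) * (1 + ‖ξ‖ ^ 2) ^ (-N)) := by
    fun_prop
  have h1 := lintegral_map (μ := (volume : Measure ℂ)) hm (measurable_const_smul R)
  rw [Measure.map_addHaar_smul volume hR.ne', lintegral_smul_measure,
    Complex.finrank_real_complex] at h1
  have h2 : ∀ ξ : ℂ, ENNReal.ofReal (‖ξ‖ ^ (s - 2) * (1 + (R * ‖ξ‖) ^ 2) ^ (-N)) =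
      ENNReal.ofReal (R ^ (2 - s)) *
        ENNReal.ofReal (‖R • ξ‖ ^ (s - 2) * (1 + ‖R • ξ‖ ^ 2) ^ (-N)) := by
    intro ξ
    rw [← ENNReal.ofReal_mul (by positivity), norm_smul, Real.norm_of_nonneg hR.le,
      Real.mul_rpow hR.le (norm_nonneg _), ← mul_assoc, ← mul_assoc, ← Real.rpow_add hR]
    simp
  simp only [h2]
  rw [lintegral_const_mul' _ _ ENNReal.ofReal_ne_top, ← h1, smul_eq_mul, ← mul_assoc,
    ← ENNReal.ofReal_mul (by positivity), abs_of_pos (by positivity)]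
  congr 2
  rw [Real.rpow_sub hR, Real.rpow_ofNat, Real.rpow_neg hR.le]
  field_simp

/-! ### Second moments of random integrals -/

/-- Write the square as a double integral over ν × ν and exchange it with the expectation, so that
only pair correlations remain. -/
lemma lintegral_norm_integral_sq_le {Ω X : Type*} [MeasurableSpace Ω] [MeasurableSpace X]
    (P : Measure Ω) [IsProbabilityMeasure P] (ν : Measure X) [IsFiniteMeasure ν]
    {h : Ω → X → ℂ} (hm : Measurable (Function.uncurry h)) (hb : ∀ ω x, ‖h ω x‖ ≤ 1) :
    ∫⁻ ω, ENNReal.ofReal (‖∫ x, h ω x ∂ν‖ ^ 2) ∂P ≤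
      ∫⁻ p, ‖∫ ω, h ω p.1 * (starRingEnd ℂ) (h ω p.2) ∂P‖ₑ ∂(ν.prod ν) := by
  set I : Ω → ℂ := fun ω => ∫ x, h ω x ∂ν with hI
  have hIm : StronglyMeasurable I := hm.stronglyMeasurable.integral_prod_right
  have hIb : ∀ ω, ‖I ω‖ ≤ ν.real Set.univ := fun ω => by
    simpa using norm_integral_le_of_norm_le_const (μ := ν) (Eventually.of_forall (hb ω))
  have hsq : ∀ ω, (((‖I ω‖ ^ 2 : ℝ)) : ℂ) =
      ∫ p, h ω p.1 * (starRingEnd ℂ) (h ω p.2) ∂(ν.prod ν) := by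
    intro ω
    rw [integral_prod_mul (h ω) (fun x => (starRingEnd ℂ) (h ω x)), integral_conj, Complex.mul_conj,
      Complex.normSq_eq_norm_sq]
  have hint : Integrable (fun ω => ‖I ω‖ ^ 2) P := by
    refine Integrable.of_bound (hIm.norm.pow 2).aestronglyMeasurable (ν.real Set.univ ^ 2)
      (Eventually.of_forall fun ω => ?_)
    rw [Real.norm_of_nonneg (by positivity)]
    exact pow_le_pow_left₀ (norm_nonneg _) (hIb ω) 2
  have hm2 : Measurable (Function.uncurry fun (ω : Ω) (p : X × X) =>
      h ω p.1 * (starRingEnd ℂ) (h ω p.2)) := by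
    have h1 : Measurable fun z : Ω × X × X => h z.1 z.2.1 :=
      hm.comp (measurable_fst.prodMk (measurable_fst.comp measurable_snd))
    have h2 : Measurable fun z : Ω × X × X => h z.1 z.2.2 :=
      hm.comp (measurable_fst.prodMk (measurable_snd.comp measurable_snd))
    exact h1.mul (Complex.continuous_conj.measurable.comp h2)
  have hint2 : Integrable (Function.uncurry fun (ω : Ω) (p : X × X) =>
      h ω p.1 * (starRingEnd ℂ) (h ω p.2)) (P.prod (ν.prod ν)) := by
    refine Integrable.of_bound hm2.aestronglyMeasurable 1 (Eventually.of_forall fun z => ?_)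
    simp only [Function.uncurry, norm_mul, Complex.norm_conj]
    exact mul_le_one₀ (hb _ _) (norm_nonneg _) (hb _ _)
  rw [← ofReal_integral_eq_lintegral_ofReal hint (Eventually.of_forall fun ω => by positivity)]
  calc ENNReal.ofReal (∫ ω, ‖I ω‖ ^ 2 ∂P) = ‖∫ ω, ((‖I ω‖ ^ 2 : ℝ) : ℂ) ∂P‖ₑ := by
        rw [integral_complex_ofReal, ← ofReal_norm]
        congr 1
        exact (Complex.norm_of_nonneg (integral_nonneg fun ω => by positivity)).symm
    _ = ‖∫ p, ∫ ω, h ω p.1 * (starRingEnd ℂ) (h ω p.2) ∂P ∂(ν.prod ν)‖ₑ := by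
        simp only [hsq]
        rw [integral_integral_swap hint2]
    _ ≤ _ := enorm_integral_le_lintegral_enorm _

/-! ### The random series -/

/-- A single term of the random series. -/
noncomputable def phaseTerm (a : ℕ → ℂ) (lam : ℕ → ℝ) (φ : ℕ → ℝ → ℂ) (t : ℕ → ℝ) (n : ℕ) (x : ℝ) : ℂ :=
  a n * Complex.exp (2 * (Real.pi : ℂ) * Complex.I * (t n : ℂ)) * φ n (lam n * x)

lemma norm_exp_two_pi_I_mul (θ : ℝ) :
    ‖Complex.exp (2 * (Real.pi : ℂ) * Complex.I * (θ : ℂ))‖ = 1 := by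
  rw [show 2 * (Real.pi : ℂ) * Complex.I * (θ : ℂ) = ((2 * Real.pi * θ : ℝ) : ℂ) * Complex.I by
    push_cast; ring, Complex.norm_exp_ofReal_mul_I]

section Series

variable {φ : ℕ → ℝ → ℂ} {M : ℝ} {a : ℕ → ℂ} {lam : ℕ → ℝ}

lemma norm_phaseTerm_le (hφ : ∀ n x, ‖φ n x‖ ≤ M) (t : ℕ → ℝ) (n : ℕ) (x : ℝ) :
    ‖phaseTerm a lam φ t n x‖ ≤ ‖a n‖ * M := by
  rw [phaseTerm, norm_mul, norm_mul, norm_exp_two_pi_I_mul, mul_one]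
  exact mul_le_mul_of_nonneg_left (hφ _ _) (norm_nonneg _)

lemma tendsto_phaseSeries (hφ : ∀ n x, ‖φ n x‖ ≤ M) (ha : Summable fun n => ‖a n‖)
    (t : ℕ → ℝ) (x : ℝ) :
    Tendsto (fun N => ∑ n ∈ Finset.range N, phaseTerm a lam φ t n x) atTop
      (nhds (phaseSeries a lam φ t x)) :=
  (Summable.of_norm_bounded (ha.mul_right M)
    fun n => norm_phaseTerm_le hφ t n x).hasSum.tendsto_sum_nat

lemma continuous_phaseSeries (hφ : ∀ n x, ‖φ n x‖ ≤ M) (hφc : ∀ n, Continuous (φ n))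
    (ha : Summable fun n => ‖a n‖) (t : ℕ → ℝ) : Continuous (phaseSeries a lam φ t) := by
  refine continuous_tsum (fun n => ?_) (ha.mul_right M) fun n x => norm_phaseTerm_le hφ t n x
  exact continuous_const.mul ((hφc n).comp (continuous_const_mul _))

lemma measurable_phaseSeries {Ω : Type*} [MeasurableSpace Ω] {θ : ℕ → Ω → ℝ}
    (hθ : ∀ n, Measurable (θ n)) (hφ : ∀ n x, ‖φ n x‖ ≤ M) (hφc : ∀ n, Continuous (φ n))
    (ha : Summable fun n => ‖a n‖) :
    Measurable fun p : Ω × ℝ => phaseSeries a lam φ (fun n => θ n p.1) p.2 := by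
  refine measurable_of_tendsto_metrizable
    (f := fun N (p : Ω × ℝ) => ∑ n ∈ Finset.range N, phaseTerm a lam φ (fun n => θ n p.1) n p.2)
    (fun N => ?_) (tendsto_pi_nhds.2 fun p => tendsto_phaseSeries hφ ha _ _)
  refine Finset.measurable_sum _ fun n _ => ?_
  have h1 : Measurable fun p : Ω × ℝ => θ n p.1 := (hθ n).comp measurable_fst
  have h2 : Measurable fun p : Ω × ℝ => φ n (lam n * p.2) :=
    (hφc n).measurable.comp (measurable_snd.const_mul _)
  have h3 : Measurable fun u : ℝ => a n * Complex.exp (2 * (Real.pi : ℂ) * Complex.I * (u : ℂ)) :=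
    Continuous.measurable (by fun_prop)
  exact (h3.comp h1).mul h2

lemma abs_besselZero_le_one (t : ℝ) : |besselZero t| ≤ 1 := by
  have := intervalIntegral.norm_integral_le_of_norm_le_const (a := (0 : ℝ)) (b := 1) (C := 1)
    (f := fun θ => Real.cos (t * Real.cos (2 * Real.pi * θ))) fun θ _ => Real.abs_cos_le_one _
  simpa [besselZero] using this

lemma integral_comp_isUniform {Ω : Type*} [MeasurableSpace Ω] {P : Measure Ω} {X : Ω → ℝ}
    (hX : Measurable X) (hu : pdf.IsUniform X (Set.Icc 0 1) P volume) {g : ℝ → ℂ}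
    (hg : Continuous g) : ∫ ω, g (X ω) ∂P = ∫ θ in (0 : ℝ)..1, g θ := by
  rw [← integral_map hX.aemeasurable hg.aestronglyMeasurable, hu, ProbabilityTheory.cond,
    intervalIntegral.integral_of_le zero_le_one, integral_Icc_eq_integral_Ioc.symm]
  simp

/-- The correlations of the characters along the random series are products of Bessel functions,
up to the remaining factors of modulus at most one. -/
lemma norm_integral_planeChar_le {Ω : Type*} [MeasurableSpace Ω] {P : Measure Ω}
    [IsProbabilityMeasure P] {θ : ℕ → Ω → ℝ} (hθ : ∀ n, Measurable (θ n)) (hind : iIndepFun θ P)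
    (hunif : ∀ n, pdf.IsUniform (θ n) (Set.Icc 0 1) P volume)
    (hφ : ∀ n x, ‖φ n x‖ ≤ M) (ha : Summable fun n => ‖a n‖) (ξ : ℂ) (x y : ℝ) (F : Finset ℕ) :
    ‖∫ ω, planeChar ξ (phaseSeries a lam φ (fun n => θ n ω) x) *
        (starRingEnd ℂ) (planeChar ξ (phaseSeries a lam φ (fun n => θ n ω) y)) ∂P‖ ≤
      ∏ n ∈ F, |besselZero (2 * Real.pi * ‖ξ‖ * ‖a n * (φ n (lam n * x) - φ n (lam n * y))‖)| := by
  simp only [← planeChar_sub]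
  set J : ℕ → ℝ := fun n =>
    |besselZero (2 * Real.pi * ‖ξ‖ * ‖a n * (φ n (lam n * x) - φ n (lam n * y))‖)| with hJ
  have hchar : Continuous (planeChar ξ) := continuous_planeChar.comp (Continuous.prodMk_right ξ)
  let G : ℕ → Ω → ℂ := fun N ω => planeChar ξ (∑ n ∈ Finset.range N,
    (phaseTerm a lam φ (fun n => θ n ω) n x - phaseTerm a lam φ (fun n => θ n ω) n y))
  let g : ℕ → ℝ → ℂ := fun n u => planeChar ξ (a n * (φ n (lam n * x) - φ n (lam n * y)) *
    Complex.exp (2 * (Real.pi : ℂ) * Complex.I * (u : ℂ)))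
  have hgc : ∀ n, Continuous (g n) := fun n => hchar.comp (by fun_prop)
  have hG : ∀ N ω, G N ω = ∏ n : Fin N, g n (θ n ω) := by
    intro N ω
    simp only [G, g]
    rw [planeChar_sum, Finset.prod_range]
    refine Finset.prod_congr rfl fun n _ => ?_
    congr 1
    simp only [phaseTerm]
    ring
  -- Independence factorises the expectation for a partial sum, and each factor is a circle average.
  have hGint : ∀ N, ‖∫ ω, G N ω ∂P‖ = ∏ n ∈ Finset.range N, J n := by
    intro N
    simp only [hG]
    have hind' : iIndepFun (fun n : Fin N => θ n) P := hind.precomp Fin.val_injective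
    rw [hind'.integral_fun_prod_comp (f := fun n : Fin N => g n) (fun n => (hθ n).aemeasurable)
      (fun n => (hgc n).aestronglyMeasurable), norm_prod, Finset.prod_range]
    refine Finset.prod_congr rfl fun n _ => ?_
    rw [integral_comp_isUniform (hθ n) (hunif n) (hgc n)]
    simp only [g]
    rw [integral_planeChar_circle, Complex.norm_real, Real.norm_eq_abs]
  have hlim : Tendsto (fun N => ∫ ω, G N ω ∂P) atTop
      (nhds (∫ ω, planeChar ξ (phaseSeries a lam φ (fun n => θ n ω) x -
        phaseSeries a lam φ (fun n => θ n ω) y) ∂P)) := by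
    refine tendsto_integral_of_dominated_convergence (fun _ => 1) (fun N => ?_)
      (integrable_const _) (fun N => Eventually.of_forall fun ω => (norm_planeChar _ _).le)
      (Eventually.of_forall fun ω => ?_)
    · have : Measurable (G N) := by
        have e : G N = fun ω => ∏ n : Fin N, g n (θ n ω) := funext (hG N)
        rw [e]
        exact Finset.measurable_prod _ fun n _ => (hgc n).measurable.comp (hθ n)
      exact this.aestronglyMeasurable
    · refine (hchar.tendsto _).comp ?_
      simp only [Finset.sum_sub_distrib]
      exact (tendsto_phaseSeries hφ ha _ _).sub (tendsto_phaseSeries hφ ha _ _)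
  refine le_of_tendsto hlim.norm ?_
  -- Once the partial sum includes `F`, dropping the factors outside `F` can only increase the
  -- product.
  filter_upwards [eventually_ge_atTop (F.sup id + 1)] with N hN
  rw [hGint]
  have hsub : F ⊆ Finset.range N := fun n hn => by
    have : n ≤ F.sup id := Finset.le_sup (f := id) hn
    rw [Finset.mem_range]; omega
  exact Finset.prod_le_prod_of_subset_of_le_one hsub (fun n _ => abs_nonneg _)
    fun n _ _ => abs_besselZero_le_one _

end Series

/-! ### Almost sure finiteness of the Sobolev energy, and the conclusion -/

lemma continuous_of_local_lipschitz {f : ℝ → ℂ} {L δ : ℝ} (hδ : 0 < δ)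
    (h : ∀ x y, |x - y| ≤ δ → ‖f x - f y‖ ≤ L * |x - y|) : Continuous f := by
  rw [continuous_iff_continuousAt]
  intro x
  rw [ContinuousAt, tendsto_iff_norm_sub_tendsto_zero]
  have hc : Continuous fun y : ℝ => L * |y - x| := by fun_prop
  have hlim : Tendsto (fun y : ℝ => L * |y - x|) (nhds x) (nhds 0) := by
    simpa using hc.tendsto x
  refine squeeze_zero' (Eventually.of_forall fun _ => norm_nonneg _) ?_ hlim
  filter_upwards [Metric.closedBall_mem_nhds x hδ] with y hy
  exact h y x hy

/-- The pushforward of a measure with compact support under the random series has, almost surely,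
finite Sobolev energy, as soon as the underlying Riesz energy is finite. -/
lemma ae_sobolevEnergy_lt_top {Ω : Type*} [MeasurableSpace Ω] {P : Measure Ω}
    [IsProbabilityMeasure P] {S : Ω → ℝ → ℂ} (hS : Measurable (Function.uncurry S))
    {ν : Measure ℝ} [IsFiniteMeasure ν] {K : Set ℝ} (hνK : ν Kᶜ = 0)
    {s τ N b : ℝ} (hs : 0 < s) (hτ : 0 < τ) (hN : s < 2 * N) (hb : 0 < b)
    (hcorr : ∀ ξ, ∀ x ∈ K, ∀ y ∈ K, x ≠ y →
      ‖∫ ω, planeChar ξ (S ω x) * (starRingEnd ℂ) (planeChar ξ (S ω y)) ∂P‖ ≤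
        (1 + (b * |x - y| ^ τ * ‖ξ‖) ^ 2) ^ (-N))
    (hen : ∫⁻ x, ∫⁻ y, edist x y ^ (-(s * τ)) ∂ν ∂ν < ∞) :
    ∀ᵐ ω ∂P, sobolevEnergy (ν.map (S ω)) s < ∞ := by
  have hSω : ∀ ω, Measurable (S ω) := fun ω => hS.comp measurable_prodMk_left
  have hF : ∀ ω ξ, measureFourier (ν.map (S ω)) ξ = ∫ x, planeChar ξ (S ω x) ∂ν := by
    intro ω ξ
    have hchar : Continuous (planeChar ξ) := continuous_planeChar.comp (Continuous.prodMk_right ξ)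
    exact integral_map (hSω ω).aemeasurable hchar.aestronglyMeasurable
  have hjoint : Measurable fun z : (Ω × ℂ) × ℝ => planeChar z.1.2 (S z.1.1 z.2) :=
    continuous_planeChar.measurable.comp ((measurable_snd.comp measurable_fst).prodMk
      (hS.comp ((measurable_fst.comp measurable_fst).prodMk measurable_snd)))
  have hmF : Measurable fun z : Ω × ℂ =>
      ENNReal.ofReal (‖measureFourier (ν.map (S z.1)) z.2‖ ^ 2 * ‖z.2‖ ^ (s - 2)) := by
    simp only [hF]
    have h1 : StronglyMeasurable fun z : Ω × ℂ => ∫ x, planeChar z.2 (S z.1 x) ∂ν :=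
      hjoint.stronglyMeasurable.integral_prod_right'
    have h2 : Measurable fun z : Ω × ℂ => ‖z.2‖ ^ (s - 2) := by fun_prop
    exact ((h1.norm.measurable.pow_const 2).mul h2).ennreal_ofReal
  -- It is enough that the expected energy is finite.
  refine ae_lt_top hmF.lintegral_prod_right' (ne_of_lt ?_)
  set c : ℝ≥0∞ := ∫⁻ ξ : ℂ, ENNReal.ofReal (‖ξ‖ ^ (s - 2) * (1 + ‖ξ‖ ^ 2) ^ (-N)) with hc
  have hctop : c < ∞ := lintegral_radial_lt_top hs hN
  let B : ℝ × ℝ → ℂ → ℝ := fun p ξ => (1 + (b * |p.1 - p.2| ^ τ * ‖ξ‖) ^ 2) ^ (-N)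
  have hae : ∀ᵐ p ∂(ν.prod ν), p.1 ∈ K ∧ p.2 ∈ K := by
    have h1 : ∀ᵐ x ∂ν, x ∈ K := hνK
    have e1 := (Measure.quasiMeasurePreserving_fst (μ := ν) (ν := ν)).ae h1
    have e2 := (Measure.quasiMeasurePreserving_snd (μ := ν) (ν := ν)).ae h1
    filter_upwards [e1, e2] with p hp1 hp2 using ⟨hp1, hp2⟩
  have hinner : ∀ ξ : ℂ, ∫⁻ ω, ENNReal.ofReal
      (‖measureFourier (ν.map (S ω)) ξ‖ ^ 2 * ‖ξ‖ ^ (s - 2)) ∂P ≤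
      ∫⁻ p, ENNReal.ofReal (‖ξ‖ ^ (s - 2) * B p ξ) ∂(ν.prod ν) := by
    intro ξ
    have hm : Measurable (Function.uncurry fun (ω : Ω) (x : ℝ) => planeChar ξ (S ω x)) :=
      (continuous_planeChar.comp (Continuous.prodMk_right ξ)).measurable.comp hS
    have hr : 0 ≤ ‖ξ‖ ^ (s - 2) := by positivity
    calc _ = ENNReal.ofReal (‖ξ‖ ^ (s - 2)) *
          ∫⁻ ω, ENNReal.ofReal (‖∫ x, planeChar ξ (S ω x) ∂ν‖ ^ 2) ∂P := by
          rw [← lintegral_const_mul' _ _ ENNReal.ofReal_ne_top]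
          refine lintegral_congr fun ω => ?_
          rw [hF, mul_comm, ENNReal.ofReal_mul hr]
      _ ≤ ENNReal.ofReal (‖ξ‖ ^ (s - 2)) * ∫⁻ p, ‖∫ ω, planeChar ξ (S ω p.1) *
            (starRingEnd ℂ) (planeChar ξ (S ω p.2)) ∂P‖ₑ ∂(ν.prod ν) := by
          gcongr
          exact lintegral_norm_integral_sq_le P ν hm fun ω x => (norm_planeChar _ _).le
      _ ≤ ENNReal.ofReal (‖ξ‖ ^ (s - 2)) * ∫⁻ p, ENNReal.ofReal (B p ξ) ∂(ν.prod ν) := by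
          refine mul_le_mul_right (lintegral_mono_ae ?_) _
          filter_upwards [hae] with p hp
          rw [← ofReal_norm]
          apply ENNReal.ofReal_le_ofReal
          by_cases hpe : p.1 = p.2
          · have hB1 : B p ξ = 1 := by simp [B, hpe, Real.zero_rpow hτ.ne']
            rw [hB1]
            refine (norm_integral_le_of_norm_le_const (C := 1) (Eventually.of_forall fun ω => ?_)).trans ?_
            · simp
            · simp
          · exact hcorr ξ p.1 hp.1 p.2 hp.2 hpe
      _ = _ := by
          rw [← lintegral_const_mul' _ _ ENNReal.ofReal_ne_top]
          refine lintegral_congr fun p => ?_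
          rw [ENNReal.ofReal_mul hr]
  -- The summand 1 keeps the constant nonzero, so that on the diagonal the right side is `∞` and not
  -- `0 * ∞ = 0`.
  have hscale : ∀ p : ℝ × ℝ, ∫⁻ ξ : ℂ, ENNReal.ofReal (‖ξ‖ ^ (s - 2) * B p ξ) ≤
      (ENNReal.ofReal (b ^ (-s)) * c + 1) * edist p.1 p.2 ^ (-(s * τ)) := by
    intro p
    by_cases hpe : p.1 = p.2
    · have h0 : edist p.1 p.2 ^ (-(s * τ)) = ∞ := by
        rw [hpe, edist_self, ENNReal.zero_rpow_of_neg (by nlinarith)]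
      rw [h0, ENNReal.mul_top (by simp)]
      exact le_top
    · have hd : 0 < |p.1 - p.2| := abs_pos.2 (sub_ne_zero.2 hpe)
      simp only [B]
      rw [lintegral_radial_scale (by positivity), Real.mul_rpow hb.le (by positivity),
        ← Real.rpow_mul hd.le, ENNReal.ofReal_mul (by positivity), edist_dist, Real.dist_eq,
        ENNReal.ofReal_rpow_of_pos hd, mul_right_comm, show τ * -s = -(s * τ) by ring]
      gcongr
      exact le_self_add
  have hmB : Measurable (Function.uncurry fun (ξ : ℂ) (p : ℝ × ℝ) =>
      ENNReal.ofReal (‖ξ‖ ^ (s - 2) * B p ξ)) := by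
    simp only [B]
    fun_prop
  calc ∫⁻ ω, sobolevEnergy (ν.map (S ω)) s ∂P
      = ∫⁻ ξ : ℂ, ∫⁻ ω, ENNReal.ofReal
        (‖measureFourier (ν.map (S ω)) ξ‖ ^ 2 * ‖ξ‖ ^ (s - 2)) ∂P :=
        lintegral_lintegral_swap hmF.aemeasurable
    _ ≤ ∫⁻ ξ : ℂ, ∫⁻ p, ENNReal.ofReal (‖ξ‖ ^ (s - 2) * B p ξ) ∂(ν.prod ν) := lintegral_mono hinner
    _ = ∫⁻ p, (∫⁻ ξ : ℂ, ENNReal.ofReal (‖ξ‖ ^ (s - 2) * B p ξ)) ∂(ν.prod ν) :=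
        lintegral_lintegral_swap hmB.aemeasurable
    _ ≤ ∫⁻ p, (ENNReal.ofReal (b ^ (-s)) * c + 1) * edist p.1 p.2 ^ (-(s * τ)) ∂(ν.prod ν) :=
        lintegral_mono hscale
    _ = (ENNReal.ofReal (b ^ (-s)) * c + 1) *
        ∫⁻ x, ∫⁻ y, edist x y ^ (-(s * τ)) ∂ν ∂ν := by
        have hme : Measurable fun p : ℝ × ℝ => edist p.1 p.2 ^ (-(s * τ)) :=
          (measurable_fst.edist measurable_snd).pow_const _
        rw [lintegral_const_mul _ hme, lintegral_prod _ hme.aemeasurable]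
    _ < ∞ := by
        refine ENNReal.mul_lt_top (ENNReal.add_lt_top.2 ⟨?_, by simp⟩) hen
        exact ENNReal.mul_lt_top ENNReal.ofReal_lt_top hctop

lemma le_sobolevDim_of_energy {f : ℝ → ℂ} (hf : Continuous f) {A K : Set ℝ} (hKA : K ⊆ A)
    (hK : IsCompact K) {ν : Measure ℝ} [IsFiniteMeasure ν] (hν0 : ν ≠ 0) (hνK : ν Kᶜ = 0)
    {s : ℝ≥0} (hs : 0 < s) (hen : sobolevEnergy (ν.map f) s < ∞) :
    (s : ℝ≥0∞) ≤ sobolevDim (f '' A) := by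
  have hsupp : SupportedMeasure (f '' A) (ν.map f) := by
    refine ⟨inferInstance, ?_, f '' K, hK.image hf, Set.image_mono hKA, ?_⟩
    · rwa [Ne, Measure.map_eq_zero_iff hf.aemeasurable]
    · rw [Measure.map_apply hf.measurable (hK.image hf).measurableSet.compl]
      refine measure_mono_null (fun x hx hxK => hx ⟨x, hxK, rfl⟩) hνK
  exact (le_iSup₂_of_le (f := fun (s : ℝ≥0) (_ : 0 < s ∧ sobolevEnergy (ν.map f) s < ∞) =>
    (s : ℝ≥0∞)) s ⟨hs, hen⟩ le_rfl).trans
      (le_iSup₂ (f := fun (μ : Measure ℂ) (_ : SupportedMeasure (f '' A) μ) => sobolevDimMeasure μ)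
        (ν.map f) hsupp)

theorem theorem3p4
    {Ω : Type*} [MeasurableSpace Ω] (P : Measure Ω) [IsProbabilityMeasure P]
    (θ : ℕ → Ω → ℝ) (hθ_meas : ∀ n, Measurable (θ n)) (hθ_indep : iIndepFun θ P)
    (hθ_unif : ∀ n, pdf.IsUniform (θ n) (Set.Icc 0 1) P volume)
    (φ : ℕ → ℝ → ℂ) (M : ℝ) (hφ_bdd : ∀ n x, ‖φ n x‖ ≤ M)
    (L δ : ℝ) (hL : 1 ≤ L) (hδ : 0 < δ)
    (hφ_lip : ∀ n x y, |x - y| ≤ δ →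
      L⁻¹ * |x - y| ≤ ‖φ n x - φ n y‖ ∧ ‖φ n x - φ n y‖ ≤ L * |x - y|)
    (a : ℕ → ℂ) (ha_ne : ∀ n, a n ≠ 0) (ha_sum : Summable fun n => ‖a n‖)
    (lam : ℕ → ℝ) (hlam_mono : Monotone lam) (hlam_zero : lam 0 = 1)
    (q : ℝ) (hq : IsLUB (Set.range fun n => lam (n + 1) / lam n) q) (hq_one : 1 < q)
    (τ : ℝ≥0) (hτ : decayExponent q lam a = ((τ : ℝ) : EReal))
    (A : Set ℝ) (hA : MeasurableSet A) (hA_dim : 0 < dimH A) :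
    ∀ᵐ ω ∂P,
      dimH A / (τ : ℝ≥0∞) ≤ sobolevDim (phaseSeries a lam φ (fun n => θ n ω) '' A) := by
  have hφc : ∀ n, Continuous (φ n) := fun n =>
    continuous_of_local_lipschitz hδ fun x y hxy => (hφ_lip n x y hxy).2
  have key : ∀ s : ℝ≥0, 0 < s → (s : ℝ≥0∞) < dimH A / τ →
      ∀ᵐ ω ∂P, (s : ℝ≥0∞) ≤ sobolevDim (phaseSeries a lam φ (fun n => θ n ω) '' A) := by
    intro s hs hlt
    have hs' : (0 : ℝ) < s := by exact_mod_cast hs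
    -- With sτ < c < dim A, the exponent τ' = c/s exceeds τ while sτ' = c remains below dim A. This
    -- also covers τ = 0.
    obtain ⟨c, hc1, hc2⟩ := ENNReal.lt_iff_exists_nnreal_btwn.1 (ENNReal.mul_lt_of_lt_div hlt)
    have hc1' : (s : ℝ) * τ < c := by exact_mod_cast hc1
    set τ' : ℝ := c / s with hτ'
    have hττ' : (τ : ℝ) < τ' := by
      rw [hτ', lt_div_iff₀ hs']; linarith
    have hτpos : 0 < τ' := lt_of_le_of_lt τ.2 hττ'
    have hsτ : s * τ' = c := by rw [hτ']; field_simp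
    obtain ⟨κ, hκ, hJ⟩ := exists_abs_besselZero_le
    -- Enough blocks for the decay order κm to exceed s/2, the threshold for radial integrability.
    obtain ⟨m, hm⟩ := exists_nat_gt ((s : ℝ) / (2 * κ))
    rw [div_lt_iff₀ (by positivity)] at hm
    obtain ⟨r, hr, b, hb, hprod⟩ := exists_prod_besselZero_le hκ hJ hL hδ
      (fun n x y hxy => (hφ_lip n x y hxy).1) hq_one hτpos
      (by rw [hτ]; exact_mod_cast hττ' : decayExponent q lam a < (τ' : EReal)) m
    obtain ⟨K, ν, hKA, hK, hfin, hν0, hνK, hKr, hen⟩ := exists_measure_energy_lt_top hA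
      (β := s * τ') (by positivity) (by rw [hsτ, ENNReal.ofReal_coe_nnreal]; exact hc2) hr
    filter_upwards [ae_sobolevEnergy_lt_top (P := P) (S := fun ω => phaseSeries a lam φ fun n => θ n ω)
      (measurable_phaseSeries hθ_meas hφ_bdd hφc ha_sum) hνK hs' hτpos
      (N := κ * m) (by linarith) hb (fun ξ x hx y hy hxy => by
        obtain ⟨F, hF⟩ := hprod x y hxy (hKr x hx y hy)
        exact (norm_integral_planeChar_le hθ_meas hθ_indep hθ_unif hφ_bdd ha_sum ξ x y F).trans
          (hF ‖ξ‖ (norm_nonneg _))) hen] with ω hω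
    exact le_sobolevDim_of_energy (continuous_phaseSeries hφ_bdd hφc ha_sum _) hKA hK hν0 hνK hs hω
  -- The exceptional null set depends on s, so only rational values are used simultaneously.
  have hrat : ∀ᵐ ω ∂P, ∀ u : ℚ, 0 < Real.toNNReal u → (Real.toNNReal u : ℝ≥0∞) < dimH A / τ →
      (Real.toNNReal u : ℝ≥0∞) ≤ sobolevDim (phaseSeries a lam φ (fun n => θ n ω) '' A) := by
    rw [ae_all_iff]
    intro u
    by_cases h1 : 0 < Real.toNNReal u
    · by_cases h2 : (Real.toNNReal u : ℝ≥0∞) < dimH A / τ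
      · filter_upwards [key _ h1 h2] with ω hω _ _ using hω
      · exact Eventually.of_forall fun ω _ h => absurd h h2
    · exact Eventually.of_forall fun ω h => absurd h h1
  filter_upwards [hrat] with ω hω
  refine le_of_forall_lt fun d hd => ?_
  obtain ⟨u, -, hdu, hu⟩ := ENNReal.lt_iff_exists_rat_btwn.1 hd
  have h0 : 0 < Real.toNNReal u := by
    have := zero_le.trans_lt hdu
    exact_mod_cast this
  exact hdu.trans_le (hω u h0 hu)
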